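/- **Theorem 2.14.** "Computable in $\exists^2$" means computable by Kleene's schemes S1–S9 with the functional $\exists^2$ as an argument, where $\exists^2(g)=0$ if $g(n)=0$ for some $n\in\mathbb N$ and $\exists^2(g)=1$ otherwise ($g\in\mathbb N^{\mathbb N}$). A real $x$ is given by any name of it, i.e. a sequence of (codes of) rationals $(q_n)$ with $|q_n-x|\le 2^{-n}$, and a function $f:[0,1]\to\mathbb R$ by any functional of type two that maps $n$ and a name of $x\in[0,1]$ to the $n$-th term of a name of $f(x)$; functions $[0,1]\times\mathbb N\to\mathbb R$ are given likewise. For $f:[0,1]\to\mathbb R$ let $C_f\subseteq[0,1]$ be its set of continuity points. * A *modulus of continuity* for $f$ is a function $M:\mathbb R\times\mathbb N\to\mathbb N$ such that for all $k\in\mathbb N$, $x\in C_f$, $y\in[0,1]$: $|x-y|<2^{-M(x,k)}$ implies $|f(x)-f(y)|<2^{-k}$. * A *modulus of usco* for $f$ is a function $\Psi:[0,1]\times\mathbb N\to\mathbb R^+$ such that for all $k\in\mathbb N$, $x,y\in[0,1]$: $|x-y|<\Psi(x,k)$ implies $f(y)<f(x)+2^{-k}$. * A *modulus of lsco restricted to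 $C_f$* is a function $L:[0,1]\times\mathbb N\to\mathbb R^+$ such that for all $k\in\mathbb N$, $x\in C_f$, $y\in[0,1]$: $|x-y|<L(x,k)$ implies $f(y)>f(x)-2^{-k}$. For upper semi-continuous (usco) $f:[0,1]\to\mathbb R$ the following hold. In each item the index of the computation does not depend on the inputs, and the result depends only on the functions and reals given, not on their representations. 1. The set $C_f$ is definable using $\exists^2$: its characteristic function $\mathbb R\to\{0,1\}$ is computable in $\exists^2$ from $f$. 2. Given a modulus of usco $\Psi$ for $f$, a modulus of continuity for $f$ is definable using $\exists^2$, i.e. computable in $\exists^2$ from $f$ and $\Psi$. 3. Given a modulus of usco $\Psi$ for $f$, $\exists^2$ computes from $f$ and $\Psi$ a point $x\in C_f$. 4. A modulus of lsco restricted to $C_f$ is computable in $\exists^2$ from $f$. 5. If $f$ is bounded below, then $\inf_{x\in[p,q]}f(x)$ is computable in $\exists^2$ from $f,p,q$, for all reals $p\le q$ in $[0,1]$. -/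

import Mathlib

namespace HigherType

/-! ### Kleene's schemes S1-S9 over the full hierarchy of pure finite types -/

/-- Total objects of pure type: type `0` is `ℕ`, and type `k + 1` consists of all functions
from type `k` to `ℕ`. -/
def PType : ℕ → Type
  | 0 => ℕ
  | k + 1 => PType k → ℕ

/-- An argument of a computation: a total object of some pure type. -/
abbrev Obj : Type := Σ k : ℕ, PType k

/-- An object of type `0`. -/
abbrev Obj.num (n : ℕ) : Obj := ⟨0, n⟩

/-- An object of type `1`. -/
abbrev Obj.seq (g : ℕ → ℕ) : Obj := ⟨1, g⟩

/-- An object of type `2`. -/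
abbrev Obj.fnl (G : (ℕ → ℕ) → ℕ) : Obj := ⟨2, G⟩

/-- `Kleene e Φ v` says that `{e}(Φ)` is defined and equals `v`, where `Φ` is a finite list of
objects of pure finite type. This is the least relation closed under the nine schemes S1-S9;
the index of a scheme with parameter `p` is the number `Nat.pair i p`, `i` the scheme's number. -/
inductive Kleene : ℕ → List Obj → ℕ → Prop
  /-- S1: `{e}(x, Φ) = x + 1`. -/
  | s1 (x : ℕ) (Φ : List Obj) : Kleene (Nat.pair 1 0) (Obj.num x :: Φ) (x + 1)
  /-- S2: `{e}(Φ) = q`. -/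
  | s2 (q : ℕ) (Φ : List Obj) : Kleene (Nat.pair 2 q) Φ q
  /-- S3: `{e}(x, Φ) = x`. -/
  | s3 (x : ℕ) (Φ : List Obj) : Kleene (Nat.pair 3 0) (Obj.num x :: Φ) x
  /-- S4: `{e}(Φ) = {a}({b}(Φ), Φ)`. -/
  | s4 (a b : ℕ) (Φ : List Obj) (u v : ℕ) (hb : Kleene b Φ u)
      (ha : Kleene a (Obj.num u :: Φ) v) : Kleene (Nat.pair 4 (Nat.pair a b)) Φ v
  /-- S5, base: `{e}(0, Φ) = {a}(Φ)`. -/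
  | s5_zero (a b : ℕ) (Φ : List Obj) (v : ℕ) (ha : Kleene a Φ v) :
      Kleene (Nat.pair 5 (Nat.pair a b)) (Obj.num 0 :: Φ) v
  /-- S5, step: `{e}(x + 1, Φ) = {b}(x, {e}(x, Φ), Φ)`. -/
  | s5_succ (a b x : ℕ) (Φ : List Obj) (u v : ℕ)
      (hx : Kleene (Nat.pair 5 (Nat.pair a b)) (Obj.num x :: Φ) u)
      (hb : Kleene b (Obj.num x :: Obj.num u :: Φ) v) :
      Kleene (Nat.pair 5 (Nat.pair a b)) (Obj.num (x + 1) :: Φ) v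
  /-- S6: `{e}(Φ₁, c, Φ₂) = {a}(c, Φ₁, Φ₂)`, where the parameter `i` is the length of `Φ₁`;
  compositions of these cyclic shifts yield all permutations of the arguments. -/
  | s6 (a : ℕ) (Φ₁ : List Obj) (c : Obj) (Φ₂ : List Obj) (v : ℕ)
      (ha : Kleene a (c :: (Φ₁ ++ Φ₂)) v) :
      Kleene (Nat.pair 6 (Nat.pair Φ₁.length a)) (Φ₁ ++ c :: Φ₂) v
  /-- S7: `{e}(g, x, Φ) = g(x)` for `g` of type `1`. -/
  | s7 (g : ℕ → ℕ) (x : ℕ) (Φ : List Obj) :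
      Kleene (Nat.pair 7 0) (Obj.seq g :: Obj.num x :: Φ) (g x)
  /-- S8: `{e}(G, Φ) = G(λ y. {a}(y, G, Φ))` for `G` of type `k + 2` and `y` of type `k`;
  this is defined only if `{a}(y, G, Φ)` is defined for every `y`. -/
  | s8 (a k : ℕ) (G : PType (k + 2)) (Φ : List Obj) (g : PType (k + 1))
      (ha : ∀ y : PType k, Kleene a (⟨k, y⟩ :: ⟨k + 2, G⟩ :: Φ) (g y)) :
      Kleene (Nat.pair 8 a) (⟨k + 2, G⟩ :: Φ) (G g)
  /-- S9: `{e}(x, Φ₁, Φ₂) = {x}(Φ₁)`, where the parameter is the length of `Φ₁`. -/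
  | s9 (x : ℕ) (Φ₁ Φ₂ : List Obj) (v : ℕ) (hx : Kleene x Φ₁ v) :
      Kleene (Nat.pair 9 Φ₁.length) (Obj.num x :: (Φ₁ ++ Φ₂)) v

open Classical in
/-- Kleene's quantifier `∃²`: it maps `g` to `0` if `g` has a zero, and to `1` otherwise. -/
noncomputable def existsTwo (g : ℕ → ℕ) : ℕ := if ∃ n, g n = 0 then 0 else 1

/-! ### Real numbers and functions on the unit interval as arguments -/

/-- The unit interval. -/
abbrev UI : Type := Set.Icc (0 : ℝ) 1

/-- The standard enumeration of the rationals: `⟨⟨a, b⟩, c⟩` codes `(a - b) / (c + 1)`. -/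
def ratOfCode (n : ℕ) : ℚ :=
  ((n.unpair.1.unpair.1 : ℚ) - (n.unpair.1.unpair.2 : ℚ)) / ((n.unpair.2 : ℚ) + 1)

/-- `α` is a name of the real `x`: a sequence of (codes of) rationals that converges to `x` with
rate `2⁻ⁿ`. -/
def IsName (α : ℕ → ℕ) (x : ℝ) : Prop :=
  ∀ n : ℕ, |(ratOfCode (α n) : ℝ) - x| ≤ 1 / 2 ^ n

/-- The sequence `n, α 0, α 1, …`; it codes the pair of a number and a sequence. -/
def prepend (n : ℕ) (α : ℕ → ℕ) : ℕ → ℕ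
  | 0 => n
  | i + 1 => α i

/-- The type-two object `F` represents `f : [0,1] → ℝ`: it maps every name `α` of a point
`x` of the unit interval to a name `n ↦ F (n, α)` of `f x`. Nothing is asked of `F` elsewhere. -/
def RepresentsFun (F : (ℕ → ℕ) → ℕ) (f : UI → ℝ) : Prop :=
  ∀ (x : UI) (α : ℕ → ℕ), IsName α x → IsName (fun n => F (prepend n α)) (f x)

/-- The type-two object `H` represents `Ψ : [0,1] × ℕ → ℝ`: for every name `α` of a point `x` of
the unit interval and every `k`, `n ↦ H (n, k, α)` is a name of `Ψ x k`. -/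
def RepresentsFunNat (H : (ℕ → ℕ) → ℕ) (Ψ : UI → ℕ → ℝ) : Prop :=
  ∀ (x : UI) (α : ℕ → ℕ) (k : ℕ), IsName α x →
    IsName (fun n => H (prepend n (prepend k α))) (Ψ x k)

/-- `{e}(n, Φ)`, as a function of `n`, is total and a name of the real `x`. -/
def ComputesReal (e : ℕ) (Φ : List Obj) (x : ℝ) : Prop :=
  ∃ β : ℕ → ℕ, IsName β x ∧ ∀ n : ℕ, Kleene e (Obj.num n :: Φ) (β n)

/-! ### Continuity points and moduli -/

/-- The set `C_f` of continuity points of `f : [0,1] → ℝ`, as a set of reals. -/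
def contSet (f : UI → ℝ) : Set ℝ :=
  {x | ∃ h : x ∈ Set.Icc (0 : ℝ) 1, ContinuousAt f ⟨x, h⟩}

/-- `M` is a modulus of continuity for `f` (at the continuity points of `f`). -/
def IsModulusOfContinuity (f : UI → ℝ) (M : ℝ → ℕ → ℕ) : Prop :=
  ∀ (k : ℕ) (x y : UI), (x : ℝ) ∈ contSet f →
    |(x : ℝ) - y| < 1 / 2 ^ M x k → |f x - f y| < 1 / 2 ^ k

/-- `Ψ` is a modulus of upper semi-continuity for `f`. -/
def IsUscoModulus (f : UI → ℝ) (Ψ : UI → ℕ → ℝ) : Prop :=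
  (∀ x k, 0 < Ψ x k) ∧
    ∀ (k : ℕ) (x y : UI), |(y : ℝ) - x| < Ψ x k → f y < f x + 1 / 2 ^ k

/-- The positive function `Ψ` is a modulus of lower semi-continuity for `f` on the set `A`. -/
def IsLscoModulusOn (A : Set ℝ) (f : UI → ℝ) (Ψ : UI → ℕ → ℝ) : Prop :=
  (∀ x k, 0 < Ψ x k) ∧
    ∀ (k : ℕ) (x y : UI), (x : ℝ) ∈ A → |(y : ℝ) - x| < Ψ x k → f x - 1 / 2 ^ k < f y

end HigherType

open HigherType

/-! The mathematical core is that lower bounds of an upper semi-continuous `f` can be tested at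
rational points. Each set `{f < a}` is open, so if `a ≤ f` at the rational points of an open set,
then `a ≤ f` on the whole set (`le_of_forall_gridPoint`). Upper semi-continuity supplies the other
half of continuity, so continuity at `x` becomes an arithmetical condition on values of `f` at `x`
and at rational points (`continuousAt_iff_exists_lowerNear`). The same reduction handles the lsco
modulus and the infima (`lt_sInf_image_Icc_iff`). Upper bounds cannot be tested this way, since `f`
may jump up at a single irrational point; there the usco modulus `Ψ` is needed. A continuity point
is the common point of nested rational intervals. By Baire, `f` is bounded below on some open part
of each interval, and a rational near-minimum `r` there exists. An interval around `r` that is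
shorter than `Ψ r k` bounds `f` from both sides in terms of `f r` (`exists_refines`). On the
computational side, `KC`, `KD` and `KR` express uniform computability of functions, relations and
lower Dedekind cuts. Their closure properties turn arithmetical definitions into indices. A trailing
list `Φ` is carried along so that an index still works when unused arguments follow. With
`existsTwo` number quantifiers are decidable, so cuts and names are interchangeable (`KR.of_isName`,
`KR.canonicalName`). -/

namespace HigherType

/-! ### Rearranging the arguments of a computation -/

/-- Adjacent initial blocks of arguments of given lengths can be exchanged. -/
theorem exists_swap (m : ℕ) : ∀ k a : ℕ, ∃ e, ∀ (A B C : List Obj) (v : ℕ), A.length = k →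
    B.length = m → Kleene a (B ++ (A ++ C)) v → Kleene e (A ++ (B ++ C)) v := by
  induction m with
  | zero =>
    intro k a
    refine ⟨a, fun A B C v _ hB h => ?_⟩
    obtain rfl := List.eq_nil_of_length_eq_zero hB
    simpa using h
  | succ m ih =>
    intro k a
    obtain ⟨e, he⟩ := ih (k + 1) a
    -- S6 at position `k + m` brings the last entry of `B` to the front, where it joins `A`. The
    -- remaining `m` entries of `B` are exchanged with this longer block.
    refine ⟨Nat.pair 6 (Nat.pair (k + m) e), fun A B C v hA hB h => ?_⟩
    obtain ⟨B, b, rfl⟩ : ∃ B' b, B = B' ++ [b] := by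
      rcases List.eq_nil_or_concat B with rfl | ⟨B', b, rfl⟩
      · simp at hB
      · exact ⟨B', b, by simp⟩
    have hB' : B.length = m := by simpa using hB
    have h1 := he (b :: A) B C v (by simp [hA]) hB' (by simpa using h)
    have h2 := Kleene.s6 e (A ++ B) b C v (by simpa using h1)
    simpa [hA, hB'] using h2

/-- Adjacent blocks of arguments of given lengths can be exchanged, after a prefix. -/
theorem exists_swap_after (j k m a : ℕ) : ∃ e, ∀ (D A B C : List Obj) (v : ℕ), D.length = j →
    A.length = k → B.length = m → Kleene a (D ++ (B ++ (A ++ C))) v →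
    Kleene e (D ++ (A ++ (B ++ C))) v := by
  -- `B` is carried past `D ++ A` to the very front (`e₂`), and then `D` past `B` (`e₁`).
  obtain ⟨e₁, h₁⟩ := exists_swap j m a
  obtain ⟨e₂, h₂⟩ := exists_swap m (j + k) e₁
  refine ⟨e₂, fun D A B C v hD hA hB h => ?_⟩
  have := h₂ (D ++ A) B C v (by simp [hD, hA]) hB (by simpa using h₁ B D (A ++ C) v hB hD h)
  simpa using this

/-- Values of computable functions can be put in front of the arguments. -/
theorem exists_push {n : ℕ} (m : ℕ) : ∀ (g : Fin m → List.Vector ℕ n → ℕ),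
    (∀ j, ∃ e, ∀ (v : List.Vector ℕ n) (Φ : List Obj),
      Kleene e (v.toList.map Obj.num ++ Φ) (g j v)) →
    ∀ a, ∃ e, ∀ (v : List.Vector ℕ n) (Φ : List Obj) (w : ℕ),
      Kleene a ((List.Vector.ofFn fun j => g j v).toList.map Obj.num ++
        (v.toList.map Obj.num ++ Φ)) w →
      Kleene e (v.toList.map Obj.num ++ Φ) w := by
  induction m with
  | zero =>
    intro g _ a
    exact ⟨a, fun v Φ w h => by simpa using h⟩
  | succ m ih =>
    intro g hg a
    obtain ⟨c, hc⟩ := hg 0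
    -- When `g 0 v` is computed, the other `m` values already stand before `v`, so its index has to
    -- skip them.
    obtain ⟨c', hc'⟩ := exists_swap n m c
    obtain ⟨e, he⟩ := ih (fun j => g j.succ) (fun j => hg j.succ) (Nat.pair 4 (Nat.pair a c'))
    refine ⟨e, fun v Φ w h => he v Φ w ?_⟩
    refine Kleene.s4 a c' _ (g 0 v) w ?_ ?_
    · exact hc' _ _ _ _ (by simp) (by simp) (hc v _)
    · simpa using h

/-- Primitive recursive functions are computable. -/
theorem exists_of_primrec' {n : ℕ} {f : List.Vector ℕ n → ℕ} (hf : Nat.Primrec' f) :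
    ∃ e, ∀ (v : List.Vector ℕ n) (Φ : List Obj),
      Kleene e (v.toList.map Obj.num ++ Φ) (f v) := by
  induction hf with
  | zero => exact ⟨Nat.pair 2 0, fun v Φ => Kleene.s2 0 _⟩
  | succ =>
    refine ⟨Nat.pair 1 0, fun v Φ => ?_⟩
    obtain ⟨x, v, rfl⟩ := v.exists_eq_cons
    simpa using Kleene.s1 x _
  | get i =>
    refine ⟨Nat.pair 6 (Nat.pair i (Nat.pair 3 0)), fun v Φ => ?_⟩
    have hi : (i : ℕ) < v.toList.length := by simp
    have h := Kleene.s6 (Nat.pair 3 0) ((v.toList.take i).map Obj.num) (Obj.num (v.get i))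
      ((v.toList.drop (i + 1)).map Obj.num ++ Φ) (v.get i) (Kleene.s3 _ _)
    have hl : ((v.toList.take i).map Obj.num).length = i := by simp
    have hv : v.toList = v.toList.take i ++ v.get i :: v.toList.drop (i + 1) := by
      rw [List.Vector.get_eq_get_toList]
      simp
    rw [hl] at h
    rw [hv]
    simpa using h
  | comp g hf hg ihf ihg =>
    obtain ⟨a, ha⟩ := ihf
    obtain ⟨e, he⟩ := exists_push _ g ihg a
    exact ⟨e, fun v Φ => he v Φ _ (ha _ _)⟩
  | @prec n f g hf hg ihf ihg =>
    obtain ⟨a, ha⟩ := ihf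
    obtain ⟨b, hb⟩ := ihg
    refine ⟨Nat.pair 5 (Nat.pair a b), fun v Φ => ?_⟩
    obtain ⟨x, v, rfl⟩ := v.exists_eq_cons
    simp only [List.Vector.toList_cons, List.map_cons, List.cons_append, List.Vector.head_cons,
      List.Vector.tail_cons]
    induction x with
    | zero => exact Kleene.s5_zero a b _ _ (ha v Φ)
    | succ x ih => exact Kleene.s5_succ a b x _ _ _ ih (by simpa using hb (x ::ᵥ _ ::ᵥ v) Φ)

theorem exists_of_primrec {n : ℕ} {f : List.Vector ℕ n → ℕ} (hf : Primrec f) :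
    ∃ e, ∀ (v : List.Vector ℕ n) (Φ : List Obj),
      Kleene e (v.toList.map Obj.num ++ Φ) (f v) :=
  exists_of_primrec' (Nat.Primrec'.of_prim hf)

/-! ### Functions that are computable uniformly in a family of arguments -/

/-- A family of lists of arguments of a common length. -/
structure ArgFamily (ι : Type) where
  /-- The lists. -/
  args : ι → List Obj
  /-- Their common length. -/
  arity : ℕ
  length_args : ∀ i, (args i).length = arity

variable {ι σ τ υ : Type} [Primcodable σ] [Primcodable τ] [Primcodable υ]

/-- `φ i s` is computable from the arguments `P i` and `s`, with an index independent of both. -/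
def KC (P : ArgFamily ι) (φ : ι → σ → τ) : Prop :=
  ∃ e, ∀ i s Φ, Kleene e (Obj.num (Encodable.encode s) :: (P.args i ++ Φ)) (Encodable.encode (φ i s))

variable {P : ArgFamily ι}

/-- A computable function can be evaluated at a primitive recursive function of leading numbers. -/
theorem KC.exists_call {φ : ι → σ → τ} (hφ : KC P φ) {k : ℕ} {h : List.Vector ℕ k → ℕ}
    (hh : Primrec h) : ∃ e, ∀ i (v : List.Vector ℕ k) Φ s, h v = Encodable.encode s →
      Kleene e (v.toList.map Obj.num ++ (P.args i ++ Φ)) (Encodable.encode (φ i s)) := by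
  obtain ⟨c, hc⟩ := hφ
  obtain ⟨b, hb⟩ := exists_of_primrec hh
  -- S4 produces the list `h v, v, P i, Φ`, but `c` expects `P i` right after its number. The swap
  -- turns `v` into a part of the ignored tail.
  obtain ⟨a, ha⟩ := exists_swap_after 1 k P.arity c
  refine ⟨Nat.pair 4 (Nat.pair a b), fun i v Φ s hs => Kleene.s4 a b _ _ _ (hb v _) ?_⟩
  rw [hs]
  exact ha [_] _ _ _ _ rfl (by simp) (P.length_args i) (hc i s _)

theorem KC.of_primrec {f : σ → τ} (hf : Primrec f) : KC P fun _ => f := by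
  have h : Primrec fun v : List.Vector ℕ 1 =>
      ((Encodable.decode v.head : Option σ).map fun s => Encodable.encode (f s)).getD 0 :=
    Primrec.option_getD.comp (Primrec.option_map (Primrec.decode.comp Primrec.vector_head)
      (Primrec.encode.comp (hf.comp Primrec.snd)).to₂) (Primrec.const 0)
  obtain ⟨e, he⟩ := exists_of_primrec h
  exact ⟨e, fun i s Φ => by simpa using he (Encodable.encode s ::ᵥ List.Vector.nil) (P.args i ++ Φ)⟩

theorem KC.comp {φ : ι → τ → υ} {ψ : ι → σ → τ} (hφ : KC P φ) (hψ : KC P ψ) :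
    KC P fun i s => φ i (ψ i s) := by
  obtain ⟨b, hb⟩ := hψ
  obtain ⟨a, ha⟩ := hφ.exists_call (k := 2) (h := fun v => v.head) Primrec.vector_head
  refine ⟨Nat.pair 4 (Nat.pair a b), fun i s Φ => Kleene.s4 a b _ _ _ (hb i s Φ) ?_⟩
  simpa using ha i (Encodable.encode (ψ i s) ::ᵥ Encodable.encode s ::ᵥ List.Vector.nil) Φ _ rfl

theorem KC.pair {φ : ι → σ → τ} {ψ : ι → σ → υ} (hφ : KC P φ) (hψ : KC P ψ) :
    KC P fun i s => (φ i s, ψ i s) := by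
  obtain ⟨b, hb⟩ := hφ
  obtain ⟨a, ha⟩ := hψ.exists_call (k := 2) (h := fun v => v.tail.head)
    (Primrec.vector_head.comp Primrec.vector_tail)
  obtain ⟨c, hc⟩ := exists_of_primrec (n := 2) (f := fun v => Nat.pair v.tail.head v.head)
    (Primrec₂.natPair.comp (Primrec.vector_head.comp Primrec.vector_tail) Primrec.vector_head)
  refine ⟨Nat.pair 4 (Nat.pair (Nat.pair 4 (Nat.pair c a)) b), fun i s Φ =>
    Kleene.s4 _ b _ _ _ (hb i s Φ) (Kleene.s4 c a _ (Encodable.encode (ψ i s)) _ ?_ ?_)⟩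
  · simpa using ha i (Encodable.encode (φ i s) ::ᵥ Encodable.encode s ::ᵥ List.Vector.nil) Φ _ rfl
  · simpa using hc (Encodable.encode (ψ i s) ::ᵥ Encodable.encode (φ i s) ::ᵥ List.Vector.nil) _

theorem ArgFamily.exists_split {i : ι} {k : ℕ} {c : Obj} (h : (P.args i)[k]? = some c) :
    ∃ A B, P.args i = A ++ c :: B ∧ A.length = k := by
  obtain ⟨hk, hc⟩ := List.getElem?_eq_some_iff.1 h
  exact ⟨(P.args i).take k, (P.args i).drop (k + 1), by simp [← hc], by simp; omega⟩

/-- Application of a type-two argument. -/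
theorem KC.fnl {G : ι → (ℕ → ℕ) → ℕ} (k : ℕ) (hG : ∀ i, (P.args i)[k]? = some (Obj.fnl (G i)))
    {φ : ι → σ × ℕ → ℕ} (hφ : KC P φ) : KC P fun i s => G i fun y => φ i (s, y) := by
  obtain ⟨c, hc⟩ := hφ.exists_call (k := 2) (h := fun v => Nat.pair v.tail.head v.head)
    (Primrec₂.natPair.comp (Primrec.vector_head.comp Primrec.vector_tail) Primrec.vector_head)
  -- S6 has to put `G` first for S8, which then prepends `y`. The index `a` returns `G` to its place
  -- behind the number and the `k` arguments before it.
  obtain ⟨a, ha⟩ := exists_swap_after 1 1 (1 + k) c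
  refine ⟨Nat.pair 6 (Nat.pair (1 + k) (Nat.pair 8 a)), fun i s Φ => ?_⟩
  obtain ⟨A, B, hP, hA⟩ := ArgFamily.exists_split (hG i)
  have h8 : Kleene (Nat.pair 8 a) (Obj.fnl (G i) :: (Obj.num (Encodable.encode s) :: A ++ (B ++ Φ)))
      (G i fun y => φ i (s, y)) := by
    refine Kleene.s8 a 0 (G i) _ (fun y => φ i (s, y)) fun (y : ℕ) => ?_
    have h := hc i (y ::ᵥ Encodable.encode s ::ᵥ List.Vector.nil) Φ (s, y) (by simp)
    refine ha [Obj.num y] [Obj.fnl (G i)] (Obj.num (Encodable.encode s) :: A) (B ++ Φ) _ rfl rfl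
      (by simp [hA, add_comm]) ?_
    simpa [hP] using h
  have h6 := Kleene.s6 _ (Obj.num (Encodable.encode s) :: A) _ _ _ h8
  simpa [hP, hA, add_comm] using h6

/-- Application of a type-one argument. -/
theorem KC.seq {g : ι → ℕ → ℕ} (k : ℕ) (hg : ∀ i, (P.args i)[k]? = some (Obj.seq (g i))) :
    KC P g := by
  refine ⟨Nat.pair 6 (Nat.pair (1 + k) (Nat.pair 7 0)), fun i s Φ => ?_⟩
  obtain ⟨A, B, hP, hA⟩ := ArgFamily.exists_split (hg i)
  have h6 := Kleene.s6 (Nat.pair 7 0) (Obj.num s :: A) (Obj.seq (g i)) (B ++ Φ) _ (Kleene.s7 _ s _)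
  simpa [hP, hA, add_comm] using h6

/-- Projection to a numerical argument. -/
theorem KC.num {g : ι → ℕ} (k : ℕ) (hg : ∀ i, (P.args i)[k]? = some (Obj.num (g i))) :
    KC P fun i (_ : σ) => g i := by
  refine ⟨Nat.pair 6 (Nat.pair (1 + k) (Nat.pair 3 0)), fun i s Φ => ?_⟩
  obtain ⟨A, B, hP, hA⟩ := ArgFamily.exists_split (hg i)
  have h6 := Kleene.s6 (Nat.pair 3 0) (Obj.num (Encodable.encode s) :: A) (Obj.num (g i)) (B ++ Φ) _
    (Kleene.s3 _ _)
  simpa [hP, hA, add_comm] using h6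

theorem KC.natRec {f : ι → σ → ℕ} {g : ι → σ × ℕ × ℕ → ℕ} (hf : KC P f) (hg : KC P g) :
    KC P fun i (p : σ × ℕ) =>
      Nat.rec (motive := fun _ => ℕ) (f i p.1) (fun y u => g i (p.1, y, u)) p.2 := by
  obtain ⟨a, ha⟩ := hf.exists_call (k := 2) (h := fun v => v.head) Primrec.vector_head
  have h2 : Primrec fun v : List.Vector ℕ 4 => v.tail.head :=
    Primrec.vector_head.comp Primrec.vector_tail
  have h3 : Primrec fun v : List.Vector ℕ 4 => v.tail.tail.head :=
    Primrec.vector_head.comp (Primrec.vector_tail.comp Primrec.vector_tail)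
  obtain ⟨b, hb⟩ := hg.exists_call (k := 4)
    (h := fun v => Nat.pair v.tail.tail.head (Nat.pair v.head v.tail.head))
    (Primrec₂.natPair.comp h3 (Primrec₂.natPair.comp Primrec.vector_head h2))
  obtain ⟨l, hl⟩ := exists_of_primrec (n := 1) (f := fun v => v.head.unpair.1)
    (Primrec.fst.comp (Primrec.unpair.comp Primrec.vector_head))
  obtain ⟨r, hr⟩ := exists_of_primrec (n := 2) (f := fun v => v.tail.head.unpair.2)
    (Primrec.snd.comp (Primrec.unpair.comp (Primrec.vector_head.comp Primrec.vector_tail)))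
  refine ⟨Nat.pair 4 (Nat.pair (Nat.pair 4 (Nat.pair (Nat.pair 5 (Nat.pair a b)) r)) l), ?_⟩
  rintro i ⟨s, n⟩ Φ
  generalize hp : Encodable.encode (s, n) = p
  have hp' : p = Nat.pair (Encodable.encode s) n := by rw [← hp]; simp
  refine Kleene.s4 _ l _ (Encodable.encode s) _ ?_ (Kleene.s4 _ r _ n _ ?_ ?_)
  · simpa [hp'] using hl (p ::ᵥ List.Vector.nil) (P.args i ++ Φ)
  · simpa [hp'] using hr (Encodable.encode s ::ᵥ p ::ᵥ List.Vector.nil) (P.args i ++ Φ)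
  -- From here on `p` is an inert list entry; its link to `n` must be forgotten for the induction.
  · clear hp hp'
    induction n with
    | zero =>
      exact Kleene.s5_zero a b _ _ (by
        simpa using ha i (Encodable.encode s ::ᵥ p ::ᵥ List.Vector.nil) Φ s rfl)
    | succ n ih =>
      exact Kleene.s5_succ a b n _ _ _ ih (by
        simpa using hb i (n ::ᵥ _ ::ᵥ Encodable.encode s ::ᵥ p ::ᵥ List.Vector.nil) Φ
          (s, n, _) (by simp))

/-- Unbounded search. -/
theorem KC.find {φ : ι → σ × ℕ → ℕ} (hφ : KC P φ) (h0 : ∀ i s, ∃ n, φ i (s, n) = 0) :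
    KC P fun i s => sInf {n | φ i (s, n) = 0} := by
  -- Values are cut down to `0` and `1`, so that S5 acts as a case distinction: its base case stops,
  -- its single step continues the search.
  have hφ' : KC P fun i p => 1 - (1 - φ i p) :=
    (KC.of_primrec (Primrec.nat_sub.comp (Primrec.const 1)
      (Primrec.nat_sub.comp (Primrec.const 1) Primrec.id))).comp hφ
  obtain ⟨c, hc⟩ := hφ'.exists_call (k := 3) (h := fun v => Nat.pair v.tail.tail.head v.tail.head)
    (Primrec₂.natPair.comp
      (Primrec.vector_head.comp (Primrec.vector_tail.comp Primrec.vector_tail))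
      (Primrec.vector_head.comp Primrec.vector_tail))
  obtain ⟨a, ha⟩ := exists_of_primrec (n := 3) (f := fun v => v.tail.head)
    (Primrec.vector_head.comp Primrec.vector_tail)
  -- The four pushed numbers are the index consumed by S9 and the new arguments `d, n + 1, s`. The
  -- five old numbers are moved behind `P i`, so that S9 discards them together with `Φ`.
  obtain ⟨r, hr⟩ := exists_swap_after 4 5 P.arity (Nat.pair 9 (P.arity + 3))
  obtain ⟨b, hb⟩ := exists_push (n := 5) 4
    ![fun v => v.get 2, fun v => v.get 2, fun v => (v.get 3).succ, fun v => v.get 4] (by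
      have h (j : Fin 5) : Primrec fun v : List.Vector ℕ 5 => v.get j :=
        Primrec.vector_get.comp Primrec.id (Primrec.const j)
      intro j
      fin_cases j
      · exact exists_of_primrec (h 2)
      · exact exists_of_primrec (h 2)
      · exact exists_of_primrec (Primrec.succ.comp (h 3))
      · exact exists_of_primrec (h 4)) r
  -- Self-application replaces the recursion theorem: `d` receives its own index as first argument
  -- and calls it through S9.
  set d := Nat.pair 4 (Nat.pair (Nat.pair 5 (Nat.pair a b)) c)
  -- Induction on the distance `j` from the current candidate `n` to the first zero `N`.
  have key (i : ι) (s : σ) (N : ℕ) (hN : φ i (s, N) = 0) (j : ℕ) :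
      ∀ n, n + j = N → (∀ m, n ≤ m → m < N → φ i (s, m) ≠ 0) →
      ∀ Φ, Kleene d (Obj.num d :: Obj.num n :: Obj.num (Encodable.encode s) :: (P.args i ++ Φ)) N := by
    induction j with
    | zero =>
      rintro n rfl _ Φ
      have hn0 : φ i (s, n) = 0 := hN
      refine Kleene.s4 _ c _ 0 _ ?_ (Kleene.s5_zero a b _ _ ?_)
      · simpa [hn0] using
          hc i (d ::ᵥ n ::ᵥ Encodable.encode s ::ᵥ List.Vector.nil) Φ (s, n) (by simp)
      · simpa using ha (d ::ᵥ n ::ᵥ Encodable.encode s ::ᵥ List.Vector.nil) (P.args i ++ Φ)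
    | succ j ih =>
      intro n hn hne Φ
      have h1 : 1 - (1 - φ i (s, n)) = 1 := by
        have := hne n le_rfl (by omega)
        omega
      refine Kleene.s4 _ c _ 1 _ ?_ (Kleene.s5_succ a b 0 _ n _ (Kleene.s5_zero a b _ _ ?_) ?_)
      · simpa [h1] using
          hc i (d ::ᵥ n ::ᵥ Encodable.encode s ::ᵥ List.Vector.nil) Φ (s, n) (by simp)
      · simpa using ha (d ::ᵥ n ::ᵥ Encodable.encode s ::ᵥ List.Vector.nil) (P.args i ++ Φ)
      · have hrec := ih (n + 1) (by omega) (fun m hm => hne m (by omega)) []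
        rw [List.append_nil] at hrec
        have h9 := Kleene.s9 d (Obj.num d :: Obj.num (n + 1) :: Obj.num (Encodable.encode s) ::
          P.args i) ([0, n, d, n, Encodable.encode s].map Obj.num ++ Φ) N hrec
        have hl : (Obj.num d :: Obj.num (n + 1) :: Obj.num (Encodable.encode s) ::
          P.args i).length = P.arity + 3 := by simp [P.length_args]
        rw [hl] at h9
        have h := hr [Obj.num d, Obj.num d, Obj.num (n + 1), Obj.num (Encodable.encode s)]
          ([0, n, d, n, Encodable.encode s].map Obj.num) (P.args i) Φ N rfl rfl (P.length_args i)
          (by simpa using h9)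
        exact hb (0 ::ᵥ n ::ᵥ d ::ᵥ n ::ᵥ Encodable.encode s ::ᵥ List.Vector.nil) (P.args i ++ Φ) N h
  obtain ⟨e, he⟩ := exists_push (n := 1) 2 ![fun _ => d, fun _ => 0] (by
      intro j
      fin_cases j
      · exact exists_of_primrec (Primrec.const d)
      · exact exists_of_primrec (Primrec.const 0)) d
  refine ⟨e, fun i s Φ => he (Encodable.encode s ::ᵥ List.Vector.nil) (P.args i ++ Φ) _ ?_⟩
  have hmem : φ i (s, sInf {n | φ i (s, n) = 0}) = 0 := Nat.sInf_mem (h0 i s)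
  exact key i s _ hmem _ 0 (zero_add _) 
    (fun m _ hm => Nat.notMem_of_lt_sInf (s := {n | φ i (s, n) = 0}) hm) Φ

/-! ### Decidable relations -/

open Classical in
/-- The relation `R i s` is decidable from the arguments `P i` and `s`, uniformly. -/
def KD (P : ArgFamily ι) (R : ι → σ → Prop) : Prop :=
  KC P fun i s => if R i s then 0 else 1

theorem KD.congr {R S : ι → σ → Prop} (hR : KD P R) (h : ∀ i s, R i s ↔ S i s) : KD P S := by
  have : R = S := by
    ext i s
    exact h i s
  rwa [← this]

theorem KD.of_primrecPred {R : σ → Prop} (hR : PrimrecPred R) : KD P fun _ => R := by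
  classical
  obtain ⟨_, h⟩ := hR
  have h2 : Primrec fun s => if R s then 0 else 1 :=
    (Primrec.cond h (Primrec.const 0) (Primrec.const 1)).of_eq fun s => by
      by_cases hs : R s <;> simp [hs]
  unfold KD
  convert KC.of_primrec (P := P) h2

theorem KD.comp {R : ι → τ → Prop} {φ : ι → σ → τ} (hR : KD P R) (hφ : KC P φ) :
    KD P fun i s => R i (φ i s) :=
  KC.comp hR hφ

theorem KD.not {R : ι → σ → Prop} (hR : KD P R) : KD P fun i s => ¬R i s := by
  have h := (KC.of_primrec (P := P) (Primrec.nat_sub.comp (Primrec.const 1) Primrec.id)).comp hR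
  unfold KD
  convert h using 3 with i s
  by_cases hs : R i s <;> simp [hs]

theorem KD.and {R S : ι → σ → Prop} (hR : KD P R) (hS : KD P S) :
    KD P fun i s => R i s ∧ S i s := by
  have h := (KC.of_primrec (P := P) (Primrec.nat_max.comp Primrec.fst Primrec.snd)).comp (hR.pair hS)
  unfold KD
  convert h using 3 with i s
  by_cases hs : R i s <;> by_cases hs' : S i s <;> simp [hs, hs']

theorem KD.or {R S : ι → σ → Prop} (hR : KD P R) (hS : KD P S) :
    KD P fun i s => R i s ∨ S i s :=
  (hR.not.and hS.not).not.congr fun i s => by tauto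

theorem KD.imp {R S : ι → σ → Prop} (hR : KD P R) (hS : KD P S) :
    KD P fun i s => R i s → S i s :=
  (hR.not.or hS).congr fun i s => by tauto

theorem KC.ite {R : ι → σ → Prop} [∀ i s, Decidable (R i s)] {φ ψ : ι → σ → τ} (hR : KD P R)
    (hφ : KC P φ) (hψ : KC P ψ) : KC P fun i s => if R i s then φ i s else ψ i s := by
  have hp : Primrec fun p : ℕ × τ × τ => if p.1 = 0 then p.2.1 else p.2.2 :=
    Primrec.ite (Primrec.eq.comp Primrec.fst (Primrec.const 0))
      (Primrec.fst.comp Primrec.snd) (Primrec.snd.comp Primrec.snd)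
  have h := (KC.of_primrec (P := P) hp).comp (KC.pair hR (hφ.pair hψ))
  convert h using 3 with i s
  by_cases hs : R i s <;> simp [hs]

theorem KC.ofFst : KC P fun (_ : ι) (p : σ × τ) => p.1 := KC.of_primrec Primrec.fst

theorem KC.ofSnd : KC P fun (_ : ι) (p : σ × τ) => p.2 := KC.of_primrec Primrec.snd

theorem KC.const (c : τ) : KC P fun (_ : ι) (_ : σ) => c := KC.of_primrec (Primrec.const c)

/-- The family has `∃²` as first argument. -/
def ArgFamily.HasExists (P : ArgFamily ι) : Prop := ∀ i, (P.args i)[0]? = some (Obj.fnl existsTwo)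

-- This is the only place where `existsTwo` is evaluated; every later use of it is a number
-- quantifier.
open Classical in
theorem KD.exists (hP : P.HasExists) {R : ι → σ → ℕ → Prop}
    (hR : KD P fun i (p : σ × ℕ) => R i p.1 p.2) : KD P fun i s => ∃ n, R i s n := by
  have h := KC.fnl (P := P) (G := fun _ => existsTwo) 0 hP hR
  unfold KD
  convert h using 3 with i s
  have h1 : (∃ n, R i s n) ↔ ∃ n, (if R i s n then (0 : ℕ) else 1) = 0 :=
    exists_congr fun n => by by_cases hn : R i s n <;> simp [hn]
  simp only [existsTwo, h1]

theorem KD.forall (hP : P.HasExists) {R : ι → σ → ℕ → Prop}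
    (hR : KD P fun i (p : σ × ℕ) => R i p.1 p.2) : KD P fun i s => ∀ n, R i s n :=
  (KD.exists hP (R := fun i s n => ¬R i s n) hR.not).not.congr fun i s => by simp

/-- Searching for the least number with a decidable property; the value is `0` if there is none. -/
theorem KC.natSInf (hP : P.HasExists) {R : ι → σ → ℕ → Prop}
    (hR : KD P fun i (p : σ × ℕ) => R i p.1 p.2) : KC P fun i s => sInf {n | R i s n} := by
  classical
  -- The second disjunct makes the search halt at `0` when there is no witness, in agreement with
  -- `sInf ∅ = 0`.
  have hS : KD P fun i (p : σ × ℕ) => R i p.1 p.2 ∨ ¬∃ n, R i p.1 n :=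
    hR.or ((KD.exists hP hR).not.comp KC.ofFst)
  have h := KC.find hS fun i s => by
    by_cases hs : ∃ n, R i s n
    · exact hs.imp fun n hn => by simp [hn]
    · exact ⟨0, by simp [hs]⟩
  convert h using 3 with i s
  by_cases hs : ∃ n, R i s n
  · congr 1
    ext n
    simp [hs]
  · have h1 : {n | R i s n} = ∅ := by
      ext n
      simpa using fun hn => hs ⟨n, hn⟩
    simp only [h1, hs, not_false_eq_true, or_true, if_true]
    simp

/-! ### Primitive recursive relations between rationals -/

theorem ratOfCode_pair (a b c : ℕ) :
    ratOfCode (Nat.pair (Nat.pair a b) c) = ((a : ℚ) - b) / (c + 1) := by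
  simp [ratOfCode]

theorem exists_ratOfCode_eq (q : ℚ) : ∃ c, ratOfCode c = q := by
  refine ⟨Nat.pair (Nat.pair q.num.toNat (-q.num).toNat) (q.den - 1), ?_⟩
  rw [ratOfCode_pair]
  have h1 : ((q.den - 1 : ℕ) : ℚ) + 1 = q.den := by
    have := q.den_pos
    rw [← Nat.cast_add_one, Nat.sub_add_cancel this]
  have h2 : ((q.num.toNat : ℕ) : ℚ) - ((-q.num).toNat : ℕ) = q.num := by
    have : ((q.num.toNat : ℕ) : ℤ) - ((-q.num).toNat : ℕ) = q.num := by omega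
    exact_mod_cast this
  rw [h1, h2, Rat.num_div_den]

theorem exists_ratOfCode_between {x y : ℝ} (h : x < y) :
    ∃ c, x < (ratOfCode c : ℝ) ∧ (ratOfCode c : ℝ) < y := by
  obtain ⟨q, h1, h2⟩ := exists_rat_btwn h
  obtain ⟨c, rfl⟩ := exists_ratOfCode_eq q
  exact ⟨c, h1, h2⟩

/-- Denominators are cleared and the subtracted parts of the numerators change sides, which leaves
an inequality of natural numbers. -/
theorem ratOfCode_add_le_iff (a b c : ℕ) : ratOfCode a + ratOfCode b ≤ ratOfCode c ↔
    a.unpair.1.unpair.1 * ((b.unpair.2 + 1) * (c.unpair.2 + 1)) +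
      b.unpair.1.unpair.1 * ((a.unpair.2 + 1) * (c.unpair.2 + 1)) +
      c.unpair.1.unpair.2 * ((a.unpair.2 + 1) * (b.unpair.2 + 1)) ≤
    a.unpair.1.unpair.2 * ((b.unpair.2 + 1) * (c.unpair.2 + 1)) +
      b.unpair.1.unpair.2 * ((a.unpair.2 + 1) * (c.unpair.2 + 1)) +
      c.unpair.1.unpair.1 * ((a.unpair.2 + 1) * (b.unpair.2 + 1)) := by
  unfold ratOfCode
  rw [div_add_div _ _ (by positivity) (by positivity), div_le_div_iff₀ (by positivity)
    (by positivity), ← Nat.cast_le (α := ℚ)]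
  push_cast
  constructor <;> intro h <;> linarith

/-- The single relation between rationals that is needed: since `0` codes `0`, it yields the order
with `b = 0` and negation with `c = 0`. -/
theorem primrecPred_ratOfCode_add_le :
    PrimrecPred fun p : ℕ × ℕ × ℕ => ratOfCode p.1 + ratOfCode p.2.1 ≤ ratOfCode p.2.2 := by
  have hn {f : ℕ × ℕ × ℕ → ℕ} (hf : Primrec f) : Primrec fun p => (f p).unpair.1.unpair.1 :=
    Primrec.fst.comp (Primrec.unpair.comp (Primrec.fst.comp (Primrec.unpair.comp hf)))
  have hm {f : ℕ × ℕ × ℕ → ℕ} (hf : Primrec f) : Primrec fun p => (f p).unpair.1.unpair.2 :=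
    Primrec.snd.comp (Primrec.unpair.comp (Primrec.fst.comp (Primrec.unpair.comp hf)))
  have hd {f : ℕ × ℕ × ℕ → ℕ} (hf : Primrec f) : Primrec fun p => (f p).unpair.2 + 1 :=
    Primrec.succ.comp (Primrec.snd.comp (Primrec.unpair.comp hf))
  have ha : Primrec fun p : ℕ × ℕ × ℕ => p.1 := Primrec.fst
  have hb : Primrec fun p : ℕ × ℕ × ℕ => p.2.1 := Primrec.fst.comp Primrec.snd
  have hc : Primrec fun p : ℕ × ℕ × ℕ => p.2.2 := Primrec.snd.comp Primrec.snd
  have mul {f g : ℕ × ℕ × ℕ → ℕ} (hf : Primrec f) (hg : Primrec g) : Primrec fun p => f p * g p :=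
    Primrec.nat_mul.comp hf hg
  have add {f g : ℕ × ℕ × ℕ → ℕ} (hf : Primrec f) (hg : Primrec g) : Primrec fun p => f p + g p :=
    Primrec.nat_add.comp hf hg
  refine PrimrecPred.of_eq (Primrec.nat_le.comp (add (add (mul (hn ha) (mul (hd hb) (hd hc)))
      (mul (hn hb) (mul (hd ha) (hd hc)))) (mul (hm hc) (mul (hd ha) (hd hb))))
    (add (add (mul (hm ha) (mul (hd hb) (hd hc)))
      (mul (hm hb) (mul (hd ha) (hd hc)))) (mul (hn hc) (mul (hd ha) (hd hb)))))
    fun p => (ratOfCode_add_le_iff _ _ _).symm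

theorem ratOfCode_zero : ratOfCode 0 = 0 := by simp [ratOfCode]

/-! ### Computable real-valued functions -/

/-- The lower Dedekind cut of `r i s` is decidable from the arguments `P i` and `s`. -/
def KR (P : ArgFamily ι) (r : ι → σ → ℝ) : Prop :=
  KD P fun i (p : σ × ℕ) => (ratOfCode p.2 : ℝ) < r i p.1

theorem KR.ratOfCode {φ : ι → σ → ℕ} (hφ : KC P φ) : KR P fun i s => (ratOfCode (φ i s) : ℝ) := by
  have h := (KD.of_primrecPred (P := P) primrecPred_ratOfCode_add_le).not.comp
    ((hφ.comp KC.ofFst).pair ((KC.const 0).pair (KC.ofSnd (σ := σ) (τ := ℕ))))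
  refine KD.congr h fun i p => ?_
  simp [ratOfCode_zero]

theorem KR.comp {r : ι → τ → ℝ} {φ : ι → σ → τ} (hr : KR P r) (hφ : KC P φ) :
    KR P fun i s => r i (φ i s) :=
  KD.comp (φ := fun i (p : σ × ℕ) => (φ i p.1, p.2)) hr ((hφ.comp KC.ofFst).pair KC.ofSnd)

/-- A rational in `[r, t)` witnesses the inequality, and both bounds on it are read off the lower
cuts. -/
theorem KR.lt (hP : P.HasExists) {r t : ι → σ → ℝ} (hr : KR P r) (ht : KR P t) :
    KD P fun i s => r i s < t i s := by
  refine (KD.exists hP (R := fun i s c => ¬(HigherType.ratOfCode c : ℝ) < r i s ∧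
    (HigherType.ratOfCode c : ℝ) < t i s) (KD.and (KD.not hr) ht)).congr fun i s => ?_
  constructor
  · rintro ⟨c, h1, h2⟩
    exact (not_lt.1 h1).trans_lt h2
  · intro h
    obtain ⟨c, h1, h2⟩ := exists_ratOfCode_between h
    exact ⟨c, h1.le.not_gt, h2⟩

theorem KR.le (hP : P.HasExists) {r t : ι → σ → ℝ} (hr : KR P r) (ht : KR P t) :
    KD P fun i s => r i s ≤ t i s :=
  (KR.lt hP ht hr).not.congr fun _ _ => not_lt

theorem KR.neg (hP : P.HasExists) {r : ι → σ → ℝ} (hr : KR P r) : KR P fun i s => -r i s := by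
  have hlt : KD P fun i (q : (σ × ℕ) × ℕ) => r i q.1.1 < (HigherType.ratOfCode q.2 : ℝ) :=
    KR.lt hP (hr.comp (KC.ofFst.comp KC.ofFst)) (KR.ratOfCode KC.ofSnd)
  have hle : KD P fun (_ : ι) (q : (σ × ℕ) × ℕ) =>
      HigherType.ratOfCode q.1.2 + HigherType.ratOfCode q.2 ≤ HigherType.ratOfCode 0 := by
    have hc : KC P fun (_ : ι) (q : (σ × ℕ) × ℕ) => (q.1.2, q.2, 0) :=
      (KC.ofSnd.comp KC.ofFst).pair (KC.ofSnd.pair (KC.const 0))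
    have h := (KD.of_primrecPred (P := P) primrecPred_ratOfCode_add_le).comp hc
    exact h
  refine (KD.exists hP (R := fun i p d => r i p.1 < (HigherType.ratOfCode d : ℝ) ∧
    HigherType.ratOfCode p.2 + HigherType.ratOfCode d ≤ HigherType.ratOfCode 0)
    (hlt.and hle)).congr fun i p => ?_
  simp only [ratOfCode_zero]
  constructor
  · rintro ⟨d, h1, h2⟩
    have : (HigherType.ratOfCode p.2 : ℝ) + HigherType.ratOfCode d ≤ 0 := by exact_mod_cast h2
    linarith
  · intro h
    obtain ⟨d, hd⟩ := exists_ratOfCode_eq (-HigherType.ratOfCode p.2)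
    refine ⟨d, ?_, by rw [hd]; simp⟩
    rw [hd]
    push_cast
    linarith

/-- A rational lies below `r + t` exactly if it lies below `a + b` for some rationals `a < r` and `b
< t`. -/
theorem KR.add (hP : P.HasExists) {r t : ι → σ → ℝ} (hr : KR P r) (ht : KR P t) :
    KR P fun i s => r i s + t i s := by
  have h1 : KD P fun i (q : ((σ × ℕ) × ℕ) × ℕ) => (HigherType.ratOfCode q.1.2 : ℝ) < r i q.1.1.1 :=
    KR.lt hP (KR.ratOfCode (KC.ofSnd.comp KC.ofFst))
      (hr.comp (KC.ofFst.comp (KC.ofFst.comp KC.ofFst)))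
  have h2 : KD P fun i (q : ((σ × ℕ) × ℕ) × ℕ) => (HigherType.ratOfCode q.2 : ℝ) < t i q.1.1.1 :=
    KR.lt hP (KR.ratOfCode KC.ofSnd) (ht.comp (KC.ofFst.comp (KC.ofFst.comp KC.ofFst)))
  have h3 : KD P fun (_ : ι) (q : ((σ × ℕ) × ℕ) × ℕ) =>
      ¬(HigherType.ratOfCode q.1.2 + HigherType.ratOfCode q.2 ≤ HigherType.ratOfCode q.1.1.2) :=
    ((KD.of_primrecPred (P := P) primrecPred_ratOfCode_add_le).comp
      ((KC.ofSnd.comp KC.ofFst).pair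
        (KC.ofSnd.pair (KC.ofSnd.comp (KC.ofFst.comp KC.ofFst))))).not
  refine KD.congr (KD.exists hP (R := fun i (p : σ × ℕ) a => ∃ b,
    (HigherType.ratOfCode a : ℝ) < r i p.1 ∧ (HigherType.ratOfCode b : ℝ) < t i p.1 ∧
      ¬(HigherType.ratOfCode a + HigherType.ratOfCode b ≤ HigherType.ratOfCode p.2)) (KD.exists hP
    (R := fun i (q : (σ × ℕ) × ℕ) b => (HigherType.ratOfCode q.2 : ℝ) < r i q.1.1 ∧
      (HigherType.ratOfCode b : ℝ) < t i q.1.1 ∧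
      ¬(HigherType.ratOfCode q.2 + HigherType.ratOfCode b ≤ HigherType.ratOfCode q.1.2))
    (h1.and (h2.and h3)))) fun i p => ?_
  constructor
  · rintro ⟨a, b, ha, hb, hab⟩
    have : (HigherType.ratOfCode p.2 : ℝ) < HigherType.ratOfCode a + HigherType.ratOfCode b := by
      exact_mod_cast not_le.1 hab
    linarith
  · intro h
    obtain ⟨a, ha1, ha2⟩ := exists_ratOfCode_between
      (show (HigherType.ratOfCode p.2 : ℝ) - t i p.1 < r i p.1 by linarith)
    obtain ⟨b, hb1, hb2⟩ := exists_ratOfCode_between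
      (show (HigherType.ratOfCode p.2 : ℝ) - HigherType.ratOfCode a < t i p.1 by linarith)
    refine ⟨a, b, ha2, hb2, not_le.2 ?_⟩
    have : (HigherType.ratOfCode p.2 : ℝ) < HigherType.ratOfCode a + HigherType.ratOfCode b := by
      linarith
    exact_mod_cast this

theorem KR.sub (hP : P.HasExists) {r t : ι → σ → ℝ} (hr : KR P r) (ht : KR P t) :
    KR P fun i s => r i s - t i s := by
  simpa only [sub_eq_add_neg] using KR.add hP hr (KR.neg hP ht)

theorem KR.max {r t : ι → σ → ℝ} (hr : KR P r) (ht : KR P t) :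
    KR P fun i s => max (r i s) (t i s) :=
  (KD.or hr ht).congr fun _ _ => lt_max_iff.symm

theorem KR.min {r t : ι → σ → ℝ} (hr : KR P r) (ht : KR P t) :
    KR P fun i s => min (r i s) (t i s) :=
  (KD.and hr ht).congr fun _ _ => lt_min_iff.symm

theorem KR.abs (hP : P.HasExists) {r : ι → σ → ℝ} (hr : KR P r) : KR P fun i s => |r i s| :=
  KR.max hr (KR.neg hP hr)

theorem KR.constRat (q : ℚ) : KR P fun (_ : ι) (_ : σ) => (q : ℝ) := by
  obtain ⟨c, rfl⟩ := exists_ratOfCode_eq q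
  exact KR.ratOfCode (KC.const c)

theorem KR.zero : KR P fun (_ : ι) (_ : σ) => (0 : ℝ) := by simpa using KR.constRat (P := P) 0

theorem KR.one : KR P fun (_ : ι) (_ : σ) => (1 : ℝ) := by simpa using KR.constRat (P := P) 1

/-- A code of `2⁻ⁿ`. -/
def halfPowCode (n : ℕ) : ℕ := Nat.pair (Nat.pair 1 0) (2 ^ n - 1)

theorem ratOfCode_halfPowCode (n : ℕ) : (ratOfCode (halfPowCode n) : ℝ) = 1 / 2 ^ n := by
  rw [halfPowCode, ratOfCode_pair]
  have : (((2 ^ n - 1 : ℕ) : ℝ) + 1) = 2 ^ n := by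
    rw [← Nat.cast_add_one, Nat.sub_add_cancel Nat.one_le_two_pow]
    push_cast
    rfl
  push_cast at this ⊢
  rw [this]
  simp

theorem primrec_halfPowCode : Primrec halfPowCode := by
  have h : Primrec fun n : ℕ => 2 ^ n :=
    (Primrec.nat_rec₁ (f := fun _ u => u * 2) 1
      (Primrec.nat_mul.comp Primrec.snd (Primrec.const 2)).to₂).of_eq fun n => by
      induction n with
      | zero => rfl
      | succ n ih => simp only [ih, pow_succ]
  exact Primrec₂.natPair.comp (Primrec.const _) (Primrec.nat_sub.comp h (Primrec.const 1))

theorem KR.halfPow {φ : ι → σ → ℕ} (hφ : KC P φ) : KR P fun i s => (1 / 2 ^ φ i s : ℝ) := by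
  have h := KR.ratOfCode ((KC.of_primrec primrec_halfPowCode).comp hφ)
  simpa only [ratOfCode_halfPowCode] using h

/-! ### Names -/

/-- The name of `x` that consists of the least possible codes. -/
noncomputable def canonicalName (x : ℝ) (n : ℕ) : ℕ :=
  sInf {c | |(ratOfCode c : ℝ) - x| ≤ 1 / 2 ^ n}

theorem isName_canonicalName (x : ℝ) : IsName (canonicalName x) x := fun n => by
  have hne : {c | |(ratOfCode c : ℝ) - x| ≤ 1 / 2 ^ n}.Nonempty := by
    have hpos : (0 : ℝ) < 1 / 2 ^ n := by positivity
    obtain ⟨c, h1, h2⟩ := exists_ratOfCode_between (show x < x + 1 / 2 ^ n by linarith)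
    refine ⟨c, ?_⟩
    rw [Set.mem_ofPred_eq, abs_le]
    constructor <;> linarith
  exact Nat.sInf_mem hne

/-- The passage from cuts to names. It produces the sequences to which representing functionals are
applied. -/
theorem KR.canonicalName (hP : P.HasExists) {r : ι → σ → ℝ} (hr : KR P r) :
    KC P fun i (p : σ × ℕ) => canonicalName (r i p.1) p.2 :=
  KC.natSInf hP (R := fun i (p : σ × ℕ) c => |(HigherType.ratOfCode c : ℝ) - r i p.1| ≤ 1 / 2 ^ p.2)
    (KR.le hP (KR.abs hP (KR.sub hP (KR.ratOfCode KC.ofSnd) (hr.comp (KC.ofFst.comp KC.ofFst))))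
      (KR.halfPow (KC.ofSnd.comp KC.ofFst)))

theorem IsName.lt_iff {α : ℕ → ℕ} {x : ℝ} (h : IsName α x) (a : ℝ) :
    a < x ↔ ∃ n, a + 1 / 2 ^ n < ratOfCode (α n) := by
  constructor
  · intro ha
    -- Half of the gap covers the error of the approximation, the other half the required margin.
    obtain ⟨n, hn⟩ := exists_pow_lt_of_lt_one (half_pos (sub_pos.2 ha)) (one_half_lt_one (α := ℝ))
    rw [one_div_pow] at hn
    exact ⟨n, by linarith [(abs_le.1 (h n)).1]⟩
  · rintro ⟨n, hn⟩
    linarith [(abs_le.1 (h n)).2]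

/-- The passage from names to cuts: by `IsName.lt_iff` membership in the lower cut is one number
quantifier over the name. -/
theorem KR.of_isName (hP : P.HasExists) {r : ι → σ → ℝ} {φ : ι → σ × ℕ → ℕ} (hφ : KC P φ)
    (h : ∀ i s, IsName (fun n => φ i (s, n)) (r i s)) : KR P r := by
  have h1 : KR P fun (_ : ι) (q : (σ × ℕ) × ℕ) => (HigherType.ratOfCode q.1.2 : ℝ) + 1 / 2 ^ q.2 :=
    KR.add hP (KR.ratOfCode (KC.ofSnd.comp KC.ofFst)) (KR.halfPow KC.ofSnd)
  have hc : KC P fun (_ : ι) (q : (σ × ℕ) × ℕ) => (q.1.1, q.2) :=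
    (KC.ofFst.comp KC.ofFst).pair KC.ofSnd
  have h2 : KR P fun i (q : (σ × ℕ) × ℕ) => (HigherType.ratOfCode (φ i (q.1.1, q.2)) : ℝ) :=
    KR.ratOfCode (hφ.comp hc)
  have h3 : KD P fun i (p : σ × ℕ) => ∃ n,
      (HigherType.ratOfCode p.2 : ℝ) + 1 / 2 ^ n < HigherType.ratOfCode (φ i (p.1, n)) :=
    KD.exists hP (KR.lt hP h1 h2)
  have h4 i (p : σ × ℕ) := (h i p.1).lt_iff (HigherType.ratOfCode p.2)
  exact KD.congr h3 fun i p => (h4 i p).symm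

theorem KR.seq (hP : P.HasExists) {x : ι → ℝ} {α : ι → ℕ → ℕ} (k : ℕ)
    (hα : ∀ i, (P.args i)[k]? = some (Obj.seq (α i))) (h : ∀ i, IsName (α i) (x i)) :
    KR P fun i (_ : σ) => x i :=
  KR.of_isName hP (φ := fun i (p : σ × ℕ) => α i p.2) ((KC.seq k hα).comp KC.ofSnd) fun i _ => h i

theorem KC.prepend {φ : ι → σ → ℕ} {ψ : ι → σ × ℕ → ℕ} (hφ : KC P φ) (hψ : KC P ψ) :
    KC P fun i (p : σ × ℕ) => prepend (φ i p.1) (fun y => ψ i (p.1, y)) p.2 := by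
  have h : KC P fun i (p : σ × ℕ) => if p.2 = 0 then φ i p.1 else ψ i (p.1, p.2 - 1) :=
    KC.ite ((KD.of_primrecPred (Primrec.eq.comp Primrec.snd (Primrec.const 0))))
      (hφ.comp KC.ofFst) (hψ.comp (KC.ofFst.pair ((KC.of_primrec Primrec.pred).comp KC.ofSnd)))
  convert h using 3 with i p
  rcases p with ⟨s, _ | n⟩ <;> simp [HigherType.prepend]

/-- Evaluation of a represented function at a computable point. -/
theorem KR.apply (hP : P.HasExists) {f : ι → UI → ℝ} {F : ι → (ℕ → ℕ) → ℕ} (k : ℕ)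
    (hF : ∀ i, (P.args i)[k]? = some (Obj.fnl (F i))) (h : ∀ i, RepresentsFun (F i) (f i))
    {x : ι → σ → UI} (hx : KR P fun i s => (x i s : ℝ)) : KR P fun i s => f i (x i s) := by
  have hc : KC P fun (_ : ι) (q : (σ × ℕ) × ℕ) => (q.1.1, q.2) :=
    (KC.ofFst.comp KC.ofFst).pair KC.ofSnd
  have h1 : KC P fun i (q : (σ × ℕ) × ℕ) =>
      HigherType.prepend q.1.2 (HigherType.canonicalName (x i q.1.1)) q.2 :=
    KC.prepend (ψ := fun i (q : (σ × ℕ) × ℕ) => HigherType.canonicalName (x i q.1.1) q.2)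
      KC.ofSnd ((hx.canonicalName hP).comp hc)
  have h2 := KC.fnl k hF h1
  have h3 i s := h i (x i s) _ (isName_canonicalName _)
  exact KR.of_isName hP h2 h3

/-- Evaluation of a represented function with a numerical argument at a computable point. -/
theorem KR.applyNat (hP : P.HasExists) {Ψ : ι → UI → ℕ → ℝ} {H : ι → (ℕ → ℕ) → ℕ} (k : ℕ)
    (hH : ∀ i, (P.args i)[k]? = some (Obj.fnl (H i))) (h : ∀ i, RepresentsFunNat (H i) (Ψ i))
    {x : ι → σ → UI} (hx : KR P fun i s => (x i s : ℝ)) {φ : ι → σ → ℕ} (hφ : KC P φ) :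
    KR P fun i s => Ψ i (x i s) (φ i s) := by
  have hc : KC P fun (_ : ι) (q : (σ × ℕ) × ℕ) => (q.1.1, q.2) :=
    (KC.ofFst.comp KC.ofFst).pair KC.ofSnd
  have h1 : KC P fun i (q : (σ × ℕ) × ℕ) =>
      HigherType.prepend (φ i q.1.1) (HigherType.canonicalName (x i q.1.1)) q.2 :=
    KC.prepend (ψ := fun i (q : (σ × ℕ) × ℕ) => HigherType.canonicalName (x i q.1.1) q.2)
      (hφ.comp KC.ofFst)
      ((hx.canonicalName hP).comp hc)
  have h2 : KC P fun i (q : (σ × ℕ) × ℕ) =>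
      HigherType.prepend q.1.2
        (HigherType.prepend (φ i q.1.1) (HigherType.canonicalName (x i q.1.1))) q.2 :=
    KC.prepend (φ := fun _ (q : σ × ℕ) => q.2) KC.ofSnd h1
  have h3 := KC.fnl k hH h2
  have h4 i s := h i (x i s) _ (φ i s) (isName_canonicalName _)
  exact KR.of_isName hP h3 h4

/-! ### Indices of computations -/

theorem KC.exists_index {φ : ι → σ → ℕ} (hφ : KC P φ) (s : σ) :
    ∃ e, ∀ i, Kleene e (P.args i) (φ i s) := by
  obtain ⟨a, ha⟩ := hφ
  exact ⟨Nat.pair 4 (Nat.pair a (Nat.pair 2 (Encodable.encode s))), fun i =>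
    Kleene.s4 _ _ _ _ _ (Kleene.s2 _ _) (by simpa using ha i s [])⟩

theorem KC.exists_computesReal {φ : ι → ℕ → ℕ} (hφ : KC P φ) {x : ι → ℝ}
    (h : ∀ i, IsName (φ i) (x i)) : ∃ e, ∀ i, ComputesReal e (P.args i) (x i) := by
  obtain ⟨e, he⟩ := hφ
  exact ⟨e, fun i => ⟨φ i, h i, fun n => by simpa using he i n []⟩⟩

theorem KR.exists_computesReal (hP : P.HasExists) {x : ι → ℝ}
    (hx : KR P fun i (_ : Unit) => x i) : ∃ e, ∀ i, ComputesReal e (P.args i) (x i) :=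
  KC.exists_computesReal (φ := fun i n => HigherType.canonicalName (x i) n)
    ((hx.canonicalName hP).comp ((KC.const ()).pair (KC.of_primrec Primrec.id)))
    fun _ => isName_canonicalName _

end HigherType

namespace HigherType

/-! ### Upper semi-continuous functions and rational points -/

/-- An enumeration of the rational points of the unit interval. -/
noncomputable def gridPoint (c : ℕ) : UI := Set.projIcc 0 1 zero_le_one (ratOfCode c : ℝ)

theorem denseRange_gridPoint : DenseRange gridPoint := by
  have h1 : DenseRange ratOfCode := Function.Surjective.denseRange exists_ratOfCode_eq
  have h2 : DenseRange fun c => (ratOfCode c : ℝ) := Rat.denseRange_cast.comp h1 Rat.continuous_coe_real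
  exact (Set.projIcc_surjective zero_le_one).denseRange.comp h2 continuous_projIcc

theorem exists_gridPoint_mem {U : Set UI} (hU : IsOpen U) (hne : U.Nonempty) :
    ∃ c, gridPoint c ∈ U :=
  denseRange_gridPoint.exists_mem_open hU hne

variable {f : UI → ℝ}

theorem _root_.UpperSemicontinuous.isOpen_lt (hf : UpperSemicontinuous f) (a : ℝ) :
    IsOpen {y | f y < a} :=
  hf.isOpen_preimage a

/-- A lower bound at the rational points of an open set is a lower bound on the set. -/
theorem le_of_forall_gridPoint (hf : UpperSemicontinuous f) {U : Set UI} (hU : IsOpen U) {a : ℝ}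
    (h : ∀ c, gridPoint c ∈ U → a ≤ f (gridPoint c)) {y : UI} (hy : y ∈ U) : a ≤ f y := by
  by_contra! hlt
  -- A violation at one point is a violation on a nonempty open set, which contains a rational
  -- point.
  obtain ⟨c, hc1, hc2⟩ := exists_gridPoint_mem (hU.inter (hf.isOpen_lt a)) ⟨y, hy, hlt⟩
  exact (h c hc1).not_gt hc2

theorem isOpen_abs_sub_lt (x : UI) (r : ℝ) : IsOpen {y : UI | |(y : ℝ) - x| < r} :=
  isOpen_lt (by fun_prop) continuous_const

theorem isOpen_between (a b : ℝ) : IsOpen {y : UI | a < y ∧ (y : ℝ) < b} :=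
  (isOpen_lt continuous_const continuous_subtype_val).inter
    (isOpen_lt continuous_subtype_val continuous_const)

/-- At the rational points within `2⁻ᴺ` of `x` the values of `f` are at least `f x - 2⁻ᵏ`. -/
def LowerNear (f : UI → ℝ) (x : UI) (k N : ℕ) : Prop :=
  ∀ c, |(gridPoint c : ℝ) - x| < 1 / 2 ^ N → f x - 1 / 2 ^ k ≤ f (gridPoint c)

theorem LowerNear.le (hf : UpperSemicontinuous f) {x : UI} {k N : ℕ} (h : LowerNear f x k N)
    {y : UI} (hy : |(y : ℝ) - x| < 1 / 2 ^ N) : f x - 1 / 2 ^ k ≤ f y :=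
  le_of_forall_gridPoint hf (isOpen_abs_sub_lt x (1 / 2 ^ N)) h hy

theorem exists_one_div_two_pow_lt {ε : ℝ} (hε : 0 < ε) : ∃ n : ℕ, 1 / 2 ^ n < ε := by
  obtain ⟨n, hn⟩ := exists_pow_lt_of_lt_one hε (one_half_lt_one (α := ℝ))
  exact ⟨n, by rwa [one_div_pow] at hn⟩

theorem one_div_two_pow_succ (k : ℕ) : (1 / 2 ^ (k + 1) : ℝ) = 1 / 2 ^ k / 2 := by
  rw [pow_succ, div_div]

theorem one_div_two_pow_succ_lt (k : ℕ) : (1 / 2 ^ (k + 1) : ℝ) < 1 / 2 ^ k := by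
  rw [one_div_two_pow_succ]
  have : (0 : ℝ) < 1 / 2 ^ k := by positivity
  linarith

theorem _root_.ContinuousAt.exists_lowerNear {x : UI} (h : ContinuousAt f x) (k : ℕ) :
    ∃ N, LowerNear f x k N := by
  obtain ⟨δ, hδ, H⟩ := Metric.continuousAt_iff.1 h (1 / 2 ^ k) (by positivity)
  obtain ⟨N, hN⟩ := exists_one_div_two_pow_lt hδ
  refine ⟨N, fun c hc => ?_⟩
  have h1 := H (x := gridPoint c) (by
    rw [Subtype.dist_eq, Real.dist_eq]
    exact hc.trans hN)
  rw [Real.dist_eq] at h1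
  linarith [(abs_lt.1 h1).1]

/-- The upper half of continuity is the semi-continuity of `f`; the lower half extends from rational
points to a full neighbourhood by `LowerNear.le`. -/
theorem continuousAt_iff_exists_lowerNear (hf : UpperSemicontinuous f) {x : UI} :
    ContinuousAt f x ↔ ∀ k, ∃ N, LowerNear f x k N := by
  refine ⟨fun h k => h.exists_lowerNear k, fun h => ?_⟩
  rw [Metric.continuousAt_iff']
  intro ε hε
  obtain ⟨k, hk⟩ := exists_one_div_two_pow_lt hε
  obtain ⟨N, hN⟩ := h k
  filter_upwards [(hf.isOpen_lt (f x + ε)).mem_nhds (by simpa using hε),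
    (isOpen_abs_sub_lt x (1 / 2 ^ N)).mem_nhds (by simp)] with y h1 h2
  have h3 := hN.le hf h2
  have h4 : f y < f x + ε := h1
  rw [Real.dist_eq, abs_lt]
  constructor <;> linarith

theorem mem_contSet_iff (hf : UpperSemicontinuous f) (x : ℝ) : x ∈ contSet f ↔
    0 ≤ x ∧ x ≤ 1 ∧ ∀ k, ∃ N, LowerNear f (Set.projIcc 0 1 zero_le_one x) k N := by
  rw [← continuousAt_iff_exists_lowerNear hf, ← and_assoc]
  constructor
  · rintro ⟨hx, h⟩
    exact ⟨hx, by rwa [Set.projIcc_of_mem _ hx]⟩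
  · rintro ⟨hx, h⟩
    exact ⟨hx, by rwa [Set.projIcc_of_mem _ hx] at h⟩

theorem continuousAt_of_mem_contSet {x : UI} (h : (x : ℝ) ∈ contSet f) : ContinuousAt f x :=
  h.choose_spec

/-! ### Moduli -/

/-- A modulus of lower semi-continuity at the continuity points. -/
noncomputable def lscoModulus (f : UI → ℝ) (x : UI) (k : ℕ) : ℝ :=
  1 / 2 ^ sInf {N | LowerNear f x (k + 1) N}

/-- The shift to `k + 1` turns the weak inequality of `LowerNear` into a strict one. Where no `N`
exists, `sInf ∅ = 0` gives the value `1`, so the modulus is positive everywhere. -/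
theorem isLscoModulusOn_lscoModulus (hf : UpperSemicontinuous f) :
    IsLscoModulusOn (contSet f) f (lscoModulus f) := by
  refine ⟨fun x k => by unfold lscoModulus; positivity, fun k x y hx hxy => ?_⟩
  have hN : LowerNear f x (k + 1) (sInf {N | LowerNear f x (k + 1) N}) :=
    Nat.sInf_mem ((continuousAt_of_mem_contSet hx).exists_lowerNear (k + 1))
  linarith [hN.le hf hxy, one_div_two_pow_succ_lt k]

/-- A modulus of continuity at the continuity points, from a usco modulus. -/
noncomputable def continuityModulus (f : UI → ℝ) (Ψ : UI → ℕ → ℝ) (x : ℝ) (k : ℕ) : ℕ :=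
  sInf {N | 1 / 2 ^ N ≤ Ψ (Set.projIcc 0 1 zero_le_one x) k ∧
    LowerNear f (Set.projIcc 0 1 zero_le_one x) (k + 1) N}

/-- `Ψ` bounds `f y` from above and `LowerNear` bounds it from below. Both conditions persist when
`N` grows, so they can be met together. -/
theorem isModulusOfContinuity_continuityModulus (hf : UpperSemicontinuous f) {Ψ : UI → ℕ → ℝ}
    (hΨ : IsUscoModulus f Ψ) : IsModulusOfContinuity f (continuityModulus f Ψ) := by
  intro k x y hx hxy
  have hne : {N | 1 / 2 ^ N ≤ Ψ x k ∧ LowerNear f x (k + 1) N}.Nonempty := by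
    obtain ⟨N, hN⟩ := (continuousAt_of_mem_contSet hx).exists_lowerNear (k + 1)
    obtain ⟨n, hn⟩ := exists_one_div_two_pow_lt (hΨ.1 x k)
    have hle {m : ℕ} (h : m ≤ max n N) : (1 / 2 ^ max n N : ℝ) ≤ 1 / 2 ^ m :=
      one_div_le_one_div_of_le (by positivity) (pow_le_pow_right₀ one_le_two h)
    exact ⟨max n N, (hle (le_max_left _ _)).trans hn.le,
      fun c hc => hN c (hc.trans_le (hle (le_max_right _ _)))⟩
  have hmem := Nat.sInf_mem hne
  have hM : continuityModulus f Ψ x k = sInf {N | 1 / 2 ^ N ≤ Ψ x k ∧ LowerNear f x (k + 1) N} := by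
    unfold continuityModulus
    rw [Set.projIcc_val]
  rw [← hM] at hmem
  rw [abs_sub_comm] at hxy
  have h1 := hΨ.2 k x y (hxy.trans_le hmem.1)
  have h2 := hmem.2.le hf hxy
  rw [abs_lt]
  constructor <;> linarith [one_div_two_pow_succ_lt k]

/-! ### Infima -/

/-- Density applies only to the open interval, so the end points are tested separately. The rational
`d` keeps the bound away from `a`: the infimum may equal `a` although all values exceed `a`. -/
theorem lt_sInf_image_Icc_iff (hf : UpperSemicontinuous f) (hb : BddBelow (Set.range f)) {p q : UI}
    (hpq : p ≤ q) (a : ℝ) : a < sInf (f '' Set.Icc p q) ↔ ∃ d, a < (ratOfCode d : ℝ) ∧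
      (ratOfCode d : ℝ) ≤ f p ∧ (ratOfCode d : ℝ) ≤ f q ∧
      ∀ c, (p : ℝ) < gridPoint c ∧ (gridPoint c : ℝ) < q → (ratOfCode d : ℝ) ≤ f (gridPoint c) := by
  have hb' : BddBelow (f '' Set.Icc p q) := hb.mono (Set.image_subset_range _ _)
  constructor
  · intro h
    obtain ⟨d, h1, h2⟩ := exists_ratOfCode_between h
    have hle {y : UI} (hy : y ∈ Set.Icc p q) : (ratOfCode d : ℝ) ≤ f y :=
      h2.le.trans (csInf_le hb' ⟨y, hy, rfl⟩)
    exact ⟨d, h1, hle ⟨le_rfl, hpq⟩, hle ⟨hpq, le_rfl⟩, fun c hc =>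
      hle ⟨Subtype.coe_le_coe.1 hc.1.le, Subtype.coe_le_coe.1 hc.2.le⟩⟩
  · rintro ⟨d, h1, hp, hq, h⟩
    refine h1.trans_le (le_csInf ⟨f p, p, ⟨le_rfl, hpq⟩, rfl⟩ ?_)
    rintro _ ⟨y, ⟨hpy, hyq⟩, rfl⟩
    rcases hpy.eq_or_lt with rfl | hpy
    · exact hp
    rcases hyq.eq_or_lt with rfl | hyq
    · exact hq
    exact le_of_forall_gridPoint hf (isOpen_between p q) h ⟨hpy, hyq⟩

/-! ### A point of continuity -/

/-- The left end point of the coded interval. -/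
def leftEnd (s : ℕ) : ℝ := ratOfCode s.unpair.1.unpair.1

/-- The right end point of the coded interval. -/
def rightEnd (s : ℕ) : ℝ := ratOfCode s.unpair.1.unpair.2

/-- The marked point of the coded interval. -/
noncomputable def mark (s : ℕ) : UI := gridPoint s.unpair.2

/-- The interval coded by `t` lies inside that coded by `s`, its length is at most `2⁻ᵏ` and
at most `Ψ` at its marked point, and at its rational points `f` is at least its value at the
marked point minus `2⁻ᵏ`. -/
def Refines (f : UI → ℝ) (Ψ : UI → ℕ → ℝ) (k s t : ℕ) : Prop :=
  leftEnd s < leftEnd t ∧ leftEnd t < rightEnd t ∧ rightEnd t < rightEnd s ∧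
  rightEnd t - leftEnd t ≤ 1 / 2 ^ k ∧ rightEnd t - leftEnd t ≤ Ψ (mark t) k ∧
  leftEnd t ≤ mark t ∧ mark t ≤ rightEnd t ∧
  ∀ c, leftEnd t < gridPoint c ∧ gridPoint c < rightEnd t → f (mark t) - 1 / 2 ^ k ≤ f (gridPoint c)

/-- On some open part of a given nonempty open set, an upper semi-continuous function is bounded
below; a rational point of that part almost attains its infimum. -/
theorem exists_gridPoint_almost_min (hf : UpperSemicontinuous f) {U : Set UI} (hU : IsOpen U)
    (hne : U.Nonempty) {ε : ℝ} (hε : 0 < ε) :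
    ∃ V ⊆ U, IsOpen V ∧ ∃ r, gridPoint r ∈ V ∧ ∀ y ∈ V, f (gridPoint r) - ε ≤ f y := by
  have hcl (n : ℕ) : IsClosed {y | -(n : ℝ) ≤ f y} := by
    have : {y | -(n : ℝ) ≤ f y} = {y | f y < -(n : ℝ)}ᶜ := by ext; simp
    rw [this]
    exact (hf.isOpen_lt _).isClosed_compl
  have hun : ⋃ n : ℕ, {y | -(n : ℝ) ≤ f y} = Set.univ := by
    refine Set.eq_univ_of_forall fun y => Set.mem_iUnion.2 ?_
    obtain ⟨n, hn⟩ := exists_nat_ge (-f y)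
    exact ⟨n, show -(n : ℝ) ≤ f y by linarith⟩
  -- Baire category theorem: the closed sets `{-n ≤ f}` cover the interval, so their interiors have
  -- dense union.
  obtain ⟨y, hyU, hy⟩ := (dense_iUnion_interior_of_closed hcl hun).inter_open_nonempty U hU hne
  obtain ⟨n, hn⟩ := Set.mem_iUnion.1 hy
  set V := U ∩ interior {y | -(n : ℝ) ≤ f y}
  have hVo : IsOpen V := hU.inter isOpen_interior
  have hbdd : BddBelow (f '' V) := by
    refine ⟨-n, ?_⟩
    rintro _ ⟨z, hz, rfl⟩
    have h : z ∈ {y | -(n : ℝ) ≤ f y} := interior_subset hz.2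
    exact h
  obtain ⟨_, ⟨z, hz, rfl⟩, hlt⟩ := exists_lt_of_csInf_lt (⟨f y, y, ⟨hyU, hn⟩, rfl⟩ : (f '' V).Nonempty)
    (lt_add_of_pos_right _ hε)
  -- The near-minimality of `z` is an open condition, so a rational point inherits it.
  obtain ⟨r, hrV, hr⟩ := exists_gridPoint_mem (hVo.inter (hf.isOpen_lt _)) ⟨z, hz, hlt⟩
  refine ⟨V, Set.inter_subset_left, hVo, r, hrV, fun w hw => ?_⟩
  have h1 : sInf (f '' V) ≤ f w := csInf_le hbdd ⟨w, hw, rfl⟩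
  have h2 : f (gridPoint r) < sInf (f '' V) + ε := hr
  linarith

/-- The marked point is chosen before the interval, since `Ψ` at that point limits the length. -/
theorem exists_refines (hf : UpperSemicontinuous f) {Ψ : UI → ℕ → ℝ} (hΨ : IsUscoModulus f Ψ)
    (k : ℕ) {s : ℕ} (h0 : 0 ≤ leftEnd s) (hlt : leftEnd s < rightEnd s) (h1 : rightEnd s ≤ 1) :
    ∃ t, Refines f Ψ k s t := by
  have hpos : (0 : ℝ) < 1 / 2 ^ k := by positivity
  obtain ⟨z, hz1, hz2⟩ := exists_between hlt
  obtain ⟨V, hVU, hVo, r, hrV, hr⟩ := exists_gridPoint_almost_min hf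
    (isOpen_between (leftEnd s) (rightEnd s)) ⟨⟨z, by linarith, by linarith⟩, hz1, hz2⟩ hpos
  obtain ⟨δ, hδ, hball⟩ := Metric.isOpen_iff.1 hVo _ hrV
  set y := gridPoint r with hy
  obtain ⟨hy1, hy2⟩ := hVU hrV
  -- The end points are taken within `η / 2` of `y`, so `η` bounds the length, and `δ` keeps the
  -- interval inside `V`.
  set η := min (min (1 / 2 ^ k) (Ψ y k)) δ
  have hηpos : 0 < η := lt_min (lt_min hpos (hΨ.1 y k)) hδ
  have hη1 : η ≤ 1 / 2 ^ k := (min_le_left _ _).trans (min_le_left _ _)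
  have hη2 : η ≤ Ψ y k := (min_le_left _ _).trans (min_le_right _ _)
  have hη3 : η ≤ δ := min_le_right _ _
  obtain ⟨a, ha1, ha2⟩ := exists_ratOfCode_between
    (show max (leftEnd s) (y - η / 2) < y from max_lt hy1 (by linarith))
  obtain ⟨b, hb1, hb2⟩ := exists_ratOfCode_between
    (show (y : ℝ) < min (rightEnd s) (y + η / 2) from lt_min hy2 (by linarith))
  rw [max_lt_iff] at ha1
  rw [lt_min_iff] at hb2
  refine ⟨Nat.pair (Nat.pair a b) r, ?_⟩
  simp only [Refines, leftEnd, rightEnd, mark, Nat.unpair_pair, ← hy]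
  refine ⟨ha1.1, ha2.trans hb1, hb2.1, by linarith, by linarith, ha2.le, hb1.le, fun c hc => ?_⟩
  refine hr _ (hball ?_)
  rw [Metric.mem_ball, Subtype.dist_eq, Real.dist_eq, abs_lt]
  constructor <;> linarith

/-- Nested intervals on which the oscillation of `f` tends to `0`. -/
noncomputable def nestedIntervals (f : UI → ℝ) (Ψ : UI → ℕ → ℝ) (k : ℕ) : ℕ :=
  Nat.rec (motive := fun _ => ℕ) (Nat.pair (Nat.pair 0 (halfPowCode 0)) 0)
    (fun k s => sInf {t | Refines f Ψ k s t}) k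

/-- The bounds `0 ≤ left < right ≤ 1` are what `exists_refines` requires, and refinement preserves
them. Hence every `sInf` in the recursion is attained. -/
theorem nestedIntervals_spec (hf : UpperSemicontinuous f) {Ψ : UI → ℕ → ℝ}
    (hΨ : IsUscoModulus f Ψ) (k : ℕ) : 0 ≤ leftEnd (nestedIntervals f Ψ k) ∧
      leftEnd (nestedIntervals f Ψ k) < rightEnd (nestedIntervals f Ψ k) ∧
      rightEnd (nestedIntervals f Ψ k) ≤ 1 ∧
      Refines f Ψ k (nestedIntervals f Ψ k) (nestedIntervals f Ψ (k + 1)) := by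
  have hstep (k : ℕ) (h : 0 ≤ leftEnd (nestedIntervals f Ψ k) ∧
      leftEnd (nestedIntervals f Ψ k) < rightEnd (nestedIntervals f Ψ k) ∧
      rightEnd (nestedIntervals f Ψ k) ≤ 1) :
      Refines f Ψ k (nestedIntervals f Ψ k) (nestedIntervals f Ψ (k + 1)) :=
    Nat.sInf_mem (exists_refines hf hΨ k h.1 h.2.1 h.2.2)
  have h : 0 ≤ leftEnd (nestedIntervals f Ψ k) ∧
      leftEnd (nestedIntervals f Ψ k) < rightEnd (nestedIntervals f Ψ k) ∧
      rightEnd (nestedIntervals f Ψ k) ≤ 1 := by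
    induction k with
    | zero =>
      have h1 : (ratOfCode (halfPowCode 0) : ℝ) = 1 := by rw [ratOfCode_halfPowCode]; norm_num
      simp [nestedIntervals, leftEnd, rightEnd, h1, ratOfCode_zero]
    | succ k ih =>
      have := hstep k ih
      exact ⟨ih.1.trans this.1.le, this.2.1, this.2.2.1.le.trans ih.2.2⟩
  exact ⟨h.1, h.2.1, h.2.2, hstep k h⟩

/-- The point common to the nested intervals. -/
noncomputable def continuityPoint (f : UI → ℝ) (Ψ : UI → ℕ → ℝ) : ℝ :=
  ⨆ k, leftEnd (nestedIntervals f Ψ k)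

/-- End points move strictly inwards, so the limit is interior to every interval and each interval
is a neighbourhood of it. -/
theorem continuityPoint_mem (hf : UpperSemicontinuous f) {Ψ : UI → ℕ → ℝ}
    (hΨ : IsUscoModulus f Ψ) (k : ℕ) :
    leftEnd (nestedIntervals f Ψ k) < continuityPoint f Ψ ∧
      continuityPoint f Ψ < rightEnd (nestedIntervals f Ψ k) := by
  have hs := nestedIntervals_spec hf hΨ
  have hmono : StrictMono fun k => leftEnd (nestedIntervals f Ψ k) :=
    strictMono_nat_of_lt_succ fun k => (hs k).2.2.2.1
  have hanti : StrictAnti fun k => rightEnd (nestedIntervals f Ψ k) :=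
    strictAnti_nat_of_succ_lt fun k => (hs k).2.2.2.2.2.1
  have hle (j k : ℕ) : leftEnd (nestedIntervals f Ψ j) ≤ rightEnd (nestedIntervals f Ψ k) :=
    (hmono.monotone (le_max_left j k)).trans ((hs (max j k)).2.1.le.trans
      (hanti.antitone (le_max_right j k)))
  have hbdd : BddAbove (Set.range fun k => leftEnd (nestedIntervals f Ψ k)) := by
    refine ⟨rightEnd (nestedIntervals f Ψ 0), ?_⟩
    rintro _ ⟨j, rfl⟩
    exact hle j 0
  exact ⟨(hmono k.lt_succ_self).trans_le (le_ciSup hbdd (k + 1)),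
    (ciSup_le fun j => hle j (k + 1)).trans_lt (hanti k.lt_succ_self)⟩

/-- Inside the interval of stage `k + 1` all values of `f` are within `2⁻ᵏ` of the value at the
marked point: from below by density, from above because the length is at most `Ψ` there. Comparing
two points doubles the error, hence `ε / 2`. -/
theorem continuityPoint_mem_contSet (hf : UpperSemicontinuous f) {Ψ : UI → ℕ → ℝ}
    (hΨ : IsUscoModulus f Ψ) : continuityPoint f Ψ ∈ contSet f := by
  have hm := continuityPoint_mem hf hΨ
  have hs := nestedIntervals_spec hf hΨ
  have h01 : continuityPoint f Ψ ∈ Set.Icc (0 : ℝ) 1 :=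
    ⟨(hs 0).1.trans (hm 0).1.le, (hm 0).2.le.trans (hs 0).2.2.1⟩
  refine ⟨h01, ?_⟩
  set x : UI := ⟨continuityPoint f Ψ, h01⟩
  rw [Metric.continuousAt_iff']
  intro ε hε
  obtain ⟨k, hk⟩ := exists_one_div_two_pow_lt (half_pos hε)
  obtain ⟨-, hlt, -, -, hΨk, hl, hr, hlow⟩ := (hs k).2.2.2
  set t := nestedIntervals f Ψ (k + 1)
  have key (y : UI) (hy : leftEnd t < y ∧ y < rightEnd t) :
      f (mark t) - 1 / 2 ^ k ≤ f y ∧ f y < f (mark t) + 1 / 2 ^ k := by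
    refine ⟨le_of_forall_gridPoint hf (isOpen_between _ _) hlow hy, hΨ.2 k (mark t) y ?_⟩
    refine lt_of_lt_of_le ?_ hΨk
    rw [abs_lt]
    constructor <;> linarith [hy.1, hy.2]
  have hxt := key x (hm (k + 1))
  filter_upwards [(isOpen_between (leftEnd t) (rightEnd t)).mem_nhds (hm (k + 1))] with y hy
  have hyt := key y hy
  rw [Real.dist_eq, abs_lt]
  constructor <;> linarith [hyt.1, hyt.2, hxt.1, hxt.2]

/-- The index is shifted because the interval of stage `n + 1` is the one of length at most `2⁻ⁿ`.
-/
theorem isName_continuityPoint (hf : UpperSemicontinuous f) {Ψ : UI → ℕ → ℝ}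
    (hΨ : IsUscoModulus f Ψ) :
    IsName (fun n => (nestedIntervals f Ψ (n + 1)).unpair.1.unpair.1) (continuityPoint f Ψ) := by
  intro n
  have h1 := continuityPoint_mem hf hΨ (n + 1)
  have h2 := (nestedIntervals_spec hf hΨ n).2.2.2.2.2.2.1
  rw [abs_le]
  change -(1 / 2 ^ n) ≤ leftEnd _ - _ ∧ leftEnd _ - _ ≤ 1 / 2 ^ n
  have : (0 : ℝ) < 1 / 2 ^ n := by positivity
  constructor <;> linarith [h1.1, h1.2]

end HigherType

namespace HigherType

variable {ι σ : Type} [Primcodable σ] {P : ArgFamily ι}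

/-! ### Decidability of the conditions on the function -/

theorem KR.projIcc {r : ι → σ → ℝ} (hr : KR P r) :
    KR P fun i s => (Set.projIcc (0 : ℝ) 1 zero_le_one (r i s) : ℝ) := by
  simp only [Set.coe_projIcc]
  exact KR.max KR.zero (KR.min KR.one hr)

theorem KR.gridPoint {φ : ι → σ → ℕ} (hφ : KC P φ) : KR P fun i s => (gridPoint (φ i s) : ℝ) :=
  KR.projIcc (KR.ratOfCode hφ)

/-- The function `f i` can be evaluated at computable points. -/
def Evaluable (P : ArgFamily ι) (f : ι → UI → ℝ) : Prop :=
  ∀ {σ : Type} [Primcodable σ] {x : ι → σ → UI},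
    (KR P fun i s => (x i s : ℝ)) → KR P fun i s => f i (x i s)

/-- The function `Ψ i` can be evaluated at computable points and numbers. -/
def EvaluableNat (P : ArgFamily ι) (Ψ : ι → UI → ℕ → ℝ) : Prop :=
  ∀ {σ : Type} [Primcodable σ] {x : ι → σ → UI} {φ : ι → σ → ℕ},
    (KR P fun i s => (x i s : ℝ)) → KC P φ → KR P fun i s => Ψ i (x i s) (φ i s)

theorem KD.lowerNear (hP : P.HasExists) {f : ι → UI → ℝ} (hf : Evaluable P f) {x : ι → σ → UI}
    (hx : KR P fun i s => (x i s : ℝ)) {φ ψ : ι → σ → ℕ} (hφ : KC P φ) (hψ : KC P ψ) :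
    KD P fun i s => LowerNear (f i) (x i s) (φ i s) (ψ i s) := by
  have hx' : KR P fun i (p : σ × ℕ) => (x i p.1 : ℝ) :=
    KR.comp (r := fun i s => (x i s : ℝ)) hx KC.ofFst
  have hc : KR P fun (_ : ι) (p : σ × ℕ) => (HigherType.gridPoint p.2 : ℝ) :=
    KR.gridPoint KC.ofSnd
  have h1 : KD P fun i (p : σ × ℕ) =>
      |(HigherType.gridPoint p.2 : ℝ) - x i p.1| < 1 / 2 ^ ψ i p.1 :=
    KR.lt hP (KR.abs hP (KR.sub hP hc hx')) (KR.halfPow (hψ.comp KC.ofFst))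
  have h2 : KD P fun i (p : σ × ℕ) =>
      f i (x i p.1) - 1 / 2 ^ φ i p.1 ≤ f i (HigherType.gridPoint p.2) :=
    KR.le hP (KR.sub hP (hf hx') (KR.halfPow (hφ.comp KC.ofFst))) (hf hc)
  exact KD.forall hP (h1.imp h2)

theorem KD.mem_contSet (hP : P.HasExists) {f : ι → UI → ℝ} (hf : Evaluable P f)
    (hu : ∀ i, UpperSemicontinuous (f i)) {x : ι → σ → ℝ} (hx : KR P x) :
    KD P fun i s => x i s ∈ contSet (f i) := by
  have hx' : KR P fun i (p : (σ × ℕ) × ℕ) =>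
      (Set.projIcc (0 : ℝ) 1 zero_le_one (x i p.1.1) : ℝ) :=
    KR.projIcc (KR.comp hx (KC.ofFst.comp KC.ofFst))
  have h1 : KD P fun i (p : (σ × ℕ) × ℕ) =>
      LowerNear (f i) (Set.projIcc (0 : ℝ) 1 zero_le_one (x i p.1.1)) p.1.2 p.2 :=
    KD.lowerNear hP hf hx' (KC.ofSnd.comp KC.ofFst) KC.ofSnd
  have h2 : KD P fun i (p : σ × ℕ) => ∃ N,
      LowerNear (f i) (Set.projIcc (0 : ℝ) 1 zero_le_one (x i p.1)) p.2 N := KD.exists hP h1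
  have h3 : KD P fun i s => ∀ k, ∃ N,
      LowerNear (f i) (Set.projIcc (0 : ℝ) 1 zero_le_one (x i s)) k N := KD.forall hP h2
  exact KD.congr (KD.and (KR.le hP KR.zero hx) (KD.and (KR.le hP hx KR.one) h3)) fun i s =>
    (mem_contSet_iff (hu i) (x i s)).symm

theorem KR.lscoModulus (hP : P.HasExists) {f : ι → UI → ℝ} (hf : Evaluable P f) {x : ι → σ → UI}
    (hx : KR P fun i s => (x i s : ℝ)) {φ : ι → σ → ℕ} (hφ : KC P φ) :
    KR P fun i s => lscoModulus (f i) (x i s) (φ i s) := by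
  have hx' : KR P fun i (p : σ × ℕ) => (x i p.1 : ℝ) :=
    KR.comp (r := fun i s => (x i s : ℝ)) hx KC.ofFst
  have h : KD P fun i (p : σ × ℕ) => LowerNear (f i) (x i p.1) (φ i p.1 + 1) p.2 :=
    KD.lowerNear hP hf hx' ((KC.of_primrec Primrec.succ).comp (hφ.comp KC.ofFst)) KC.ofSnd
  exact KR.halfPow (KC.natSInf hP h)

theorem KC.continuityModulus (hP : P.HasExists) {f : ι → UI → ℝ} (hf : Evaluable P f)
    {Ψ : ι → UI → ℕ → ℝ} (hΨ : EvaluableNat P Ψ) {x : ι → σ → ℝ} (hx : KR P x)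
    {φ : ι → σ → ℕ} (hφ : KC P φ) :
    KC P fun i s => continuityModulus (f i) (Ψ i) (x i s) (φ i s) := by
  have hx' : KR P fun i (p : σ × ℕ) => (Set.projIcc (0 : ℝ) 1 zero_le_one (x i p.1) : ℝ) :=
    KR.projIcc (KR.comp hx KC.ofFst)
  have h1 : KD P fun i (p : σ × ℕ) =>
      1 / 2 ^ p.2 ≤ Ψ i (Set.projIcc (0 : ℝ) 1 zero_le_one (x i p.1)) (φ i p.1) :=
    KR.le hP (KR.halfPow KC.ofSnd) (hΨ hx' (hφ.comp KC.ofFst))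
  have h2 : KD P fun i (p : σ × ℕ) =>
      LowerNear (f i) (Set.projIcc (0 : ℝ) 1 zero_le_one (x i p.1)) (φ i p.1 + 1) p.2 :=
    KD.lowerNear hP hf hx' ((KC.of_primrec Primrec.succ).comp (hφ.comp KC.ofFst)) KC.ofSnd
  exact KC.natSInf hP (h1.and h2)

theorem KR.sInf_image_Icc (hP : P.HasExists) {f : ι → UI → ℝ} (hf : Evaluable P f)
    (hu : ∀ i, UpperSemicontinuous (f i)) (hb : ∀ i, BddBelow (Set.range (f i)))
    {p q : ι → σ → UI} (hp : KR P fun i s => (p i s : ℝ)) (hq : KR P fun i s => (q i s : ℝ))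
    (hpq : ∀ i s, p i s ≤ q i s) : KR P fun i s => sInf (f i '' Set.Icc (p i s) (q i s)) := by
  have hc : KC P fun (_ : ι) (t : ((σ × ℕ) × ℕ) × ℕ) => t.1.1.1 :=
    KC.ofFst.comp (KC.ofFst.comp KC.ofFst)
  have hpc : KR P fun i (t : ((σ × ℕ) × ℕ) × ℕ) => (p i t.1.1.1 : ℝ) := KR.comp (r := fun i s => (p i s : ℝ)) hp hc
  have hqc : KR P fun i (t : ((σ × ℕ) × ℕ) × ℕ) => (q i t.1.1.1 : ℝ) := KR.comp (r := fun i s => (q i s : ℝ)) hq hc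
  have hg : KR P fun (_ : ι) (t : ((σ × ℕ) × ℕ) × ℕ) => (HigherType.gridPoint t.2 : ℝ) :=
    KR.gridPoint KC.ofSnd
  have hd : KR P fun (_ : ι) (t : ((σ × ℕ) × ℕ) × ℕ) => (HigherType.ratOfCode t.1.2 : ℝ) :=
    KR.ratOfCode (KC.ofSnd.comp KC.ofFst)
  have h1 : KD P fun i (t : (σ × ℕ) × ℕ) => ∀ c, (p i t.1.1 : ℝ) < HigherType.gridPoint c ∧
      (HigherType.gridPoint c : ℝ) < q i t.1.1 →
      (HigherType.ratOfCode t.2 : ℝ) ≤ f i (HigherType.gridPoint c) :=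
    KD.forall hP (((KR.lt hP hpc hg).and (KR.lt hP hg hqc)).imp (KR.le hP hd (hf hg)))
  have hd' : KR P fun (_ : ι) (t : (σ × ℕ) × ℕ) => (HigherType.ratOfCode t.2 : ℝ) :=
    KR.ratOfCode KC.ofSnd
  have ha : KR P fun (_ : ι) (t : (σ × ℕ) × ℕ) => (HigherType.ratOfCode t.1.2 : ℝ) :=
    KR.ratOfCode (KC.ofSnd.comp KC.ofFst)
  have hc' : KC P fun (_ : ι) (t : (σ × ℕ) × ℕ) => t.1.1 := KC.ofFst.comp KC.ofFst
  have hp' : KR P fun i (t : (σ × ℕ) × ℕ) => f i (p i t.1.1) := KR.comp (r := fun i s => f i (p i s)) (hf hp) hc'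
  have hq' : KR P fun i (t : (σ × ℕ) × ℕ) => f i (q i t.1.1) := KR.comp (r := fun i s => f i (q i s)) (hf hq) hc'
  have h2 : KD P fun i (t : σ × ℕ) => ∃ d, (HigherType.ratOfCode t.2 : ℝ) < HigherType.ratOfCode d ∧
      (HigherType.ratOfCode d : ℝ) ≤ f i (p i t.1) ∧ (HigherType.ratOfCode d : ℝ) ≤ f i (q i t.1) ∧
      ∀ c, (p i t.1 : ℝ) < HigherType.gridPoint c ∧ (HigherType.gridPoint c : ℝ) < q i t.1 →
        (HigherType.ratOfCode d : ℝ) ≤ f i (HigherType.gridPoint c) :=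
    KD.exists hP ((KR.lt hP ha hd').and ((KR.le hP hd' hp').and ((KR.le hP hd' hq').and h1)))
  have h3 i (t : σ × ℕ) :=
    lt_sInf_image_Icc_iff (hu i) (hb i) (hpq i t.1) (HigherType.ratOfCode t.2)
  exact KD.congr h2 fun i t => (h3 i t).symm

theorem KC.unpairFst {φ : ι → σ → ℕ} (hφ : KC P φ) : KC P fun i s => (φ i s).unpair.1 :=
  (KC.of_primrec (Primrec.fst.comp Primrec.unpair)).comp hφ

theorem KC.unpairSnd {φ : ι → σ → ℕ} (hφ : KC P φ) : KC P fun i s => (φ i s).unpair.2 :=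
  (KC.of_primrec (Primrec.snd.comp Primrec.unpair)).comp hφ

theorem KD.refines (hP : P.HasExists) {f : ι → UI → ℝ} (hf : Evaluable P f)
    {Ψ : ι → UI → ℕ → ℝ} (hΨ : EvaluableNat P Ψ) {κ φ ψ : ι → σ → ℕ} (hκ : KC P κ) (hφ : KC P φ)
    (hψ : KC P ψ) : KD P fun i s => Refines (f i) (Ψ i) (κ i s) (φ i s) (ψ i s) := by
  have hl {σ : Type} [Primcodable σ] {φ : ι → σ → ℕ} (hφ : KC P φ) :
      KR P fun i s => leftEnd (φ i s) := KR.ratOfCode hφ.unpairFst.unpairFst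
  have hr {σ : Type} [Primcodable σ] {φ : ι → σ → ℕ} (hφ : KC P φ) :
      KR P fun i s => rightEnd (φ i s) := KR.ratOfCode hφ.unpairFst.unpairSnd
  have hm {σ : Type} [Primcodable σ] {φ : ι → σ → ℕ} (hφ : KC P φ) :
      KR P fun i s => (mark (φ i s) : ℝ) := KR.gridPoint hφ.unpairSnd
  have hψ' : KC P fun i (p : σ × ℕ) => ψ i p.1 := KC.comp hψ KC.ofFst
  have hg : KR P fun (_ : ι) (p : σ × ℕ) => (HigherType.gridPoint p.2 : ℝ) :=
    KR.gridPoint KC.ofSnd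
  have hpow : KR P fun i (p : σ × ℕ) => (1 / 2 ^ κ i p.1 : ℝ) := KR.halfPow (hκ.comp KC.ofFst)
  have hall : KD P fun i s => ∀ c, leftEnd (ψ i s) < HigherType.gridPoint c ∧
      HigherType.gridPoint c < rightEnd (ψ i s) →
      f i (mark (ψ i s)) - 1 / 2 ^ κ i s ≤ f i (HigherType.gridPoint c) :=
    KD.forall hP (((KR.lt hP (hl hψ') hg).and (KR.lt hP hg (hr hψ'))).imp
      (KR.le hP (KR.sub hP (hf (hm hψ')) hpow) (hf hg)))
  have hlen := KR.sub hP (hr hψ) (hl hψ)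
  exact (KR.lt hP (hl hφ) (hl hψ)).and <| (KR.lt hP (hl hψ) (hr hψ)).and <|
    (KR.lt hP (hr hψ) (hr hφ)).and <| (KR.le hP hlen (KR.halfPow hκ)).and <|
    (KR.le hP hlen (hΨ (hm hψ) hκ)).and <| (KR.le hP (hl hψ) (hm hψ)).and <|
    (KR.le hP (hm hψ) (hr hψ)).and hall

/-- Each stage is a search for a decidable property, iterated by `KC.natRec`; `Unit` fills the
parameter slot of that recursion. -/
theorem KC.nestedIntervals (hP : P.HasExists) {f : ι → UI → ℝ} (hf : Evaluable P f)
    {Ψ : ι → UI → ℕ → ℝ} (hΨ : EvaluableNat P Ψ) :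
    KC P fun i k => nestedIntervals (f i) (Ψ i) k := by
  have h1 : KD P fun i (p : (Unit × ℕ × ℕ) × ℕ) => Refines (f i) (Ψ i) p.1.2.1 p.1.2.2 p.2 :=
    KD.refines hP hf hΨ (KC.ofFst.comp (KC.ofSnd.comp KC.ofFst))
      (KC.ofSnd.comp (KC.ofSnd.comp KC.ofFst)) KC.ofSnd
  have h2 : KC P fun i (p : Unit × ℕ × ℕ) => sInf {t | Refines (f i) (Ψ i) p.2.1 p.2.2 t} :=
    KC.natSInf hP h1
  have h3 := KC.natRec (KC.const (P := P) (σ := Unit) (Nat.pair (Nat.pair 0 (halfPowCode 0)) 0)) h2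
  have h4 : KC P fun (_ : ι) (k : ℕ) => ((), k) := (KC.const ()).pair (KC.of_primrec Primrec.id)
  exact h3.comp h4

/-! ### Representations as inputs -/

/-- An upper semi-continuous function with a representation. -/
structure UscoInput where
  f : UI → ℝ
  usc : UpperSemicontinuous f
  F : (ℕ → ℕ) → ℕ
  represents : RepresentsFun F f

/-- An upper semi-continuous function and a usco modulus, with representations. -/
structure UscoModulusInput extends UscoInput where
  Ψ : UI → ℕ → ℝ
  isModulus : IsUscoModulus f Ψ
  H : (ℕ → ℕ) → ℕ
  representsNat : RepresentsFunNat H Ψ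

/-- A real number with a name. -/
structure RealInput where
  x : ℝ
  α : ℕ → ℕ
  isName : IsName α x

/-! ### Uniform indices for the five items -/

theorem exists_index_mem_contSet : ∃ e : ℕ, ∀ f : UI → ℝ, UpperSemicontinuous f →
    ∀ F : (ℕ → ℕ) → ℕ, RepresentsFun F f → ∀ (x : ℝ) (α : ℕ → ℕ), IsName α x →
      (x ∈ contSet f → Kleene e [Obj.fnl existsTwo, Obj.fnl F, Obj.seq α] 1) ∧
      (x ∉ contSet f → Kleene e [Obj.fnl existsTwo, Obj.fnl F, Obj.seq α] 0) := by
  classical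
  -- The family ranges over all admissible inputs with their representations, so one statement about
  -- it yields a single index for all of them.
  let P : ArgFamily (UscoInput × RealInput) :=
    ⟨fun i => [Obj.fnl existsTwo, Obj.fnl i.1.F, Obj.seq i.2.α], 3, fun _ => rfl⟩
  have hP : P.HasExists := fun _ => rfl
  have hf : Evaluable P fun i => i.1.f := fun hx =>
    KR.apply hP 1 (fun _ => rfl) (fun i => i.1.represents) hx
  have hx : KR P fun i (_ : Unit) => i.2.x := KR.seq hP 2 (fun _ => rfl) fun i => i.2.isName
  have hD := KD.mem_contSet hP hf (fun i => i.1.usc) hx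
  obtain ⟨e, he⟩ := (KC.ite hD (KC.const 1) (KC.const 0)).exists_index ()
  refine ⟨e, fun f hf F hF x α hα => ?_⟩
  have h := he (⟨f, hf, F, hF⟩, ⟨x, α, hα⟩)
  exact ⟨fun hx => by simpa [P, hx] using h, fun hx => by simpa [P, hx] using h⟩

theorem exists_index_continuityModulus : ∃ e : ℕ, ∀ f : UI → ℝ, UpperSemicontinuous f →
    ∀ Ψ : UI → ℕ → ℝ, IsUscoModulus f Ψ → ∀ F : (ℕ → ℕ) → ℕ, RepresentsFun F f →
    ∀ H : (ℕ → ℕ) → ℕ, RepresentsFunNat H Ψ → ∀ (x : ℝ) (α : ℕ → ℕ), IsName α x → ∀ k : ℕ,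
      Kleene e [Obj.fnl existsTwo, Obj.fnl F, Obj.fnl H, Obj.seq α, Obj.num k]
        (continuityModulus f Ψ x k) := by
  let P : ArgFamily (UscoModulusInput × RealInput × ℕ) :=
    ⟨fun i => [Obj.fnl existsTwo, Obj.fnl i.1.F, Obj.fnl i.1.H, Obj.seq i.2.1.α, Obj.num i.2.2], 5,
      fun _ => rfl⟩
  have hP : P.HasExists := fun _ => rfl
  have hf : Evaluable P fun i => i.1.f := fun hx =>
    KR.apply hP 1 (fun _ => rfl) (fun i => i.1.represents) hx
  have hΨ : EvaluableNat P fun i => i.1.Ψ := fun hx hφ =>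
    KR.applyNat hP 2 (fun _ => rfl) (fun i => i.1.representsNat) hx hφ
  have hx : KR P fun i (_ : Unit) => i.2.1.x := KR.seq hP 3 (fun _ => rfl) fun i => i.2.1.isName
  have hk : KC P fun i (_ : Unit) => i.2.2 := KC.num 4 fun _ => rfl
  obtain ⟨e, he⟩ := (KC.continuityModulus hP hf hΨ hx hk).exists_index ()
  exact ⟨e, fun f hf Ψ hΨ F hF H hH x α hα k =>
    he (⟨⟨f, hf, F, hF⟩, Ψ, hΨ, H, hH⟩, ⟨x, α, hα⟩, k)⟩

theorem exists_index_continuityPoint : ∃ e : ℕ, ∀ f : UI → ℝ, UpperSemicontinuous f →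
    ∀ Ψ : UI → ℕ → ℝ, IsUscoModulus f Ψ → ∀ F : (ℕ → ℕ) → ℕ, RepresentsFun F f →
    ∀ H : (ℕ → ℕ) → ℕ, RepresentsFunNat H Ψ →
      ComputesReal e [Obj.fnl existsTwo, Obj.fnl F, Obj.fnl H] (continuityPoint f Ψ) := by
  let P : ArgFamily UscoModulusInput :=
    ⟨fun i => [Obj.fnl existsTwo, Obj.fnl i.F, Obj.fnl i.H], 3, fun _ => rfl⟩
  have hP : P.HasExists := fun _ => rfl
  have hf : Evaluable P fun i => i.f := fun hx =>
    KR.apply hP 1 (fun _ => rfl) (fun i => i.represents) hx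
  have hΨ : EvaluableNat P fun i => i.Ψ := fun hx hφ =>
    KR.applyNat hP 2 (fun _ => rfl) (fun i => i.representsNat) hx hφ
  have h := ((KC.nestedIntervals hP hf hΨ).comp (KC.of_primrec Primrec.succ)).unpairFst.unpairFst
  obtain ⟨e, he⟩ := h.exists_computesReal (x := fun i => continuityPoint i.f i.Ψ)
    fun i => isName_continuityPoint i.usc i.isModulus
  exact ⟨e, fun f hf Ψ hΨ F hF H hH => he ⟨⟨f, hf, F, hF⟩, Ψ, hΨ, H, hH⟩⟩

theorem exists_index_lscoModulus : ∃ e : ℕ, ∀ f : UI → ℝ, UpperSemicontinuous f →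
    ∀ F : (ℕ → ℕ) → ℕ, RepresentsFun F f → ∀ (x : UI) (α : ℕ → ℕ), IsName α x → ∀ k : ℕ,
      ComputesReal e [Obj.fnl existsTwo, Obj.fnl F, Obj.seq α, Obj.num k] (lscoModulus f x k) := by
  let P : ArgFamily (UscoInput × RealInput × ℕ) :=
    ⟨fun i => [Obj.fnl existsTwo, Obj.fnl i.1.F, Obj.seq i.2.1.α, Obj.num i.2.2], 4, fun _ => rfl⟩
  have hP : P.HasExists := fun _ => rfl
  have hf : Evaluable P fun i => i.1.f := fun hx =>
    KR.apply hP 1 (fun _ => rfl) (fun i => i.1.represents) hx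
  have hx : KR P fun i (_ : Unit) => i.2.1.x := KR.seq hP 2 (fun _ => rfl) fun i => i.2.1.isName
  have hk : KC P fun i (_ : Unit) => i.2.2 := KC.num 3 fun _ => rfl
  -- A `RealInput` may lie outside the unit interval, so it is clamped; on points of the interval
  -- the clamping is the identity.
  obtain ⟨e, he⟩ := (KR.lscoModulus hP hf hx.projIcc hk).exists_computesReal hP
  refine ⟨e, fun f hf F hF x α hα k => ?_⟩
  simpa [P] using he (⟨f, hf, F, hF⟩, ⟨x, α, hα⟩, k)

theorem exists_index_sInf_image_Icc : ∃ e : ℕ, ∀ f : UI → ℝ, UpperSemicontinuous f →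
    BddBelow (Set.range f) → ∀ F : (ℕ → ℕ) → ℕ, RepresentsFun F f →
    ∀ p q : UI, p ≤ q → ∀ α β : ℕ → ℕ, IsName α p → IsName β q →
      ComputesReal e [Obj.fnl existsTwo, Obj.fnl F, Obj.seq α, Obj.seq β]
        (sInf (f '' Set.Icc p q)) := by
  let P : ArgFamily {i : UscoInput × RealInput × RealInput //
      BddBelow (Set.range i.1.f) ∧ i.2.1.x ≤ i.2.2.x} :=
    ⟨fun i => [Obj.fnl existsTwo, Obj.fnl i.1.1.F, Obj.seq i.1.2.1.α, Obj.seq i.1.2.2.α], 4,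
      fun _ => rfl⟩
  have hP : P.HasExists := fun _ => rfl
  have hf : Evaluable P fun i => i.1.1.f := fun hx =>
    KR.apply hP 1 (fun _ => rfl) (fun i => i.1.1.represents) hx
  have hp : KR P fun i (_ : Unit) => i.1.2.1.x := KR.seq hP 2 (fun _ => rfl) fun i => i.1.2.1.isName
  have hq : KR P fun i (_ : Unit) => i.1.2.2.x := KR.seq hP 3 (fun _ => rfl) fun i => i.1.2.2.isName
  obtain ⟨e, he⟩ := (KR.sInf_image_Icc hP hf (fun i => i.1.1.usc) (fun i => i.2.1) hp.projIcc
    hq.projIcc fun i _ => Set.monotone_projIcc _ i.2.2).exists_computesReal hP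
  refine ⟨e, fun f hf hb F hF p q hpq α β hα hβ => ?_⟩
  simpa [P] using he ⟨(⟨f, hf, F, hF⟩, ⟨p, α, hα⟩, ⟨q, β, hβ⟩), hb, hpq⟩

end HigherType

theorem theorem2p14 :
    -- the set of continuity points is definable using `∃²`, via its characteristic function
    (∃ e : ℕ, ∀ f : UI → ℝ, UpperSemicontinuous f →
      ∀ F : (ℕ → ℕ) → ℕ, RepresentsFun F f →
      ∀ (x : ℝ) (α : ℕ → ℕ), IsName α x →
        (x ∈ contSet f → Kleene e [Obj.fnl existsTwo, Obj.fnl F, Obj.seq α] 1) ∧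
        (x ∉ contSet f → Kleene e [Obj.fnl existsTwo, Obj.fnl F, Obj.seq α] 0)) ∧
    -- a modulus of continuity is definable using `∃²`, given a usco modulus
    (∃ (e : ℕ) (M : (UI → ℝ) → (UI → ℕ → ℝ) → ℝ → ℕ → ℕ),
      ∀ f : UI → ℝ, UpperSemicontinuous f → ∀ Ψ : UI → ℕ → ℝ, IsUscoModulus f Ψ →
        IsModulusOfContinuity f (M f Ψ) ∧
        ∀ F : (ℕ → ℕ) → ℕ, RepresentsFun F f →
        ∀ H : (ℕ → ℕ) → ℕ, RepresentsFunNat H Ψ →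
        ∀ (x : ℝ) (α : ℕ → ℕ), IsName α x → ∀ k : ℕ,
          Kleene e [Obj.fnl existsTwo, Obj.fnl F, Obj.fnl H, Obj.seq α, Obj.num k]
            (M f Ψ x k)) ∧
    -- a point of continuity is computable in `∃²`, given a usco modulus
    (∃ (e : ℕ) (c : (UI → ℝ) → (UI → ℕ → ℝ) → ℝ),
      ∀ f : UI → ℝ, UpperSemicontinuous f → ∀ Ψ : UI → ℕ → ℝ, IsUscoModulus f Ψ →
        c f Ψ ∈ contSet f ∧
        ∀ F : (ℕ → ℕ) → ℕ, RepresentsFun F f →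
        ∀ H : (ℕ → ℕ) → ℕ, RepresentsFunNat H Ψ →
          ComputesReal e [Obj.fnl existsTwo, Obj.fnl F, Obj.fnl H] (c f Ψ)) ∧
    -- a modulus of lsco restricted to the set of continuity points is computable in `∃²`
    (∃ (e : ℕ) (L : (UI → ℝ) → UI → ℕ → ℝ),
      ∀ f : UI → ℝ, UpperSemicontinuous f →
        IsLscoModulusOn (contSet f) f (L f) ∧
        ∀ F : (ℕ → ℕ) → ℕ, RepresentsFun F f →
        ∀ (x : UI) (α : ℕ → ℕ), IsName α x → ∀ k : ℕ,
          ComputesReal e [Obj.fnl existsTwo, Obj.fnl F, Obj.seq α, Obj.num k] (L f x k)) ∧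
    -- infima on intervals are computable in `∃²` if the function is bounded below
    (∃ (e : ℕ) (J : (UI → ℝ) → UI → UI → ℝ),
      ∀ f : UI → ℝ, UpperSemicontinuous f → BddBelow (Set.range f) →
        (∀ p q : UI, p ≤ q → IsGLB (f '' Set.Icc p q) (J f p q)) ∧
        ∀ F : (ℕ → ℕ) → ℕ, RepresentsFun F f →
        ∀ p q : UI, p ≤ q → ∀ α β : ℕ → ℕ, IsName α p → IsName β q →
          ComputesReal e [Obj.fnl existsTwo, Obj.fnl F, Obj.seq α, Obj.seq β] (J f p q)) := by
  -- The witnesses below are built from `f`, `Ψ` and the given reals alone, which makes the results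
  -- independent of the representations.
  refine ⟨exists_index_mem_contSet, ?_, ?_, ?_, ?_⟩
  · obtain ⟨e, he⟩ := exists_index_continuityModulus
    exact ⟨e, continuityModulus, fun f hf Ψ hΨ =>
      ⟨isModulusOfContinuity_continuityModulus hf hΨ, he f hf Ψ hΨ⟩⟩
  · obtain ⟨e, he⟩ := exists_index_continuityPoint
    exact ⟨e, continuityPoint, fun f hf Ψ hΨ => ⟨continuityPoint_mem_contSet hf hΨ, he f hf Ψ hΨ⟩⟩
  · obtain ⟨e, he⟩ := exists_index_lscoModulus
    exact ⟨e, lscoModulus, fun f hf => ⟨isLscoModulusOn_lscoModulus hf, he f hf⟩⟩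
  · obtain ⟨e, he⟩ := exists_index_sInf_image_Icc
    refine ⟨e, fun f p q => sInf (f '' Set.Icc p q), fun f hf hb => ⟨fun p q hpq => ?_, he f hf hb⟩⟩
    exact isGLB_csInf ⟨f p, p, ⟨le_rfl, hpq⟩, rfl⟩ (hb.mono (Set.image_subset_range _ _))
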